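/- Let $k$ be a field and let $\mathcal O=\{\mathcal O(n)\}_{n\ge 0}$ be a graded non-symmetric operad over $k$, that is, a DG operad with zero differential, with infinitesimal compositions $\circ_i$. Let $\mathrm s\mathcal O$ be its operadic suspension, $\mathrm s\mathcal O(n)=\mathcal O(n)[1-n]$, where for $x\in\mathcal O(p)$ of degree $|x|$ and $y\in\mathcal O(q)$ the composition $x\circ_i y$ in $\mathrm s\mathcal O$ is $(-1)^{(q-1)(p-i+|x|)}$ times the one in $\mathcal O$. Write $x\{y\}=\sum_{i=1}^{p}x\circ_i y$ for $x$ of arity $p$, and let $m_2\in\mathrm s\mathcal O(2)^1=\mathcal O(2)^0$ be a multiplication, i.e. $m_2\{m_2\}=0$ in $\mathrm s\mathcal O$. The operad complex is $C^{p,q}(\mathrm s\mathcal O)=\mathrm s\mathcal O(p)^{p+q-1}=\mathcal O(p)^q$, $p\ge 0$, $q\in\mathbb Z$, with differential $d\colon C^{p,q}\to C^{p+1,q}$, $d(x)=[m_2,x]=m_2\{x\}-(-1)^{p+q-1}x\{m_2\}$, and cohomology $H^{p,q}(\mathrm s\mathcal O)$. Suppose that $$H^{n+2,-n}(\mathrm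 s\mathcal O)=0\qquad\text{for all } n\ge 1.$$ Let $\mathcal A_\infty$ be the DG operad of (non-unital) $A_\infty$-algebras, freely generated as a graded operad by operations $m_n$ of arity $n$ and degree $2-n$, $n\ge 2$; a morphism of DG operads $g\colon\mathcal A_\infty\to\mathcal O$ amounts to operations $m_n^g\in\mathcal O(n)^{2-n}$, $n\ge 2$, with $\sum_{p+q=n+2}m^g_p\{m^g_q\}=0$ in $\mathrm s\mathcal O$ for all $n\ge 2$. Then there is a unique morphism $f\colon\mathcal A_\infty\to\mathcal O$ with $m_2^f=m_2$ and $m_n^f=0$ for $n\ge 3$; it is the composite $\mathcal A_\infty\to\mathcal{A}ss\to\mathcal O$ of the canonical morphism to the non-unital associative operad and a morphism that sends the binary product to $m_2$. Moreover, every morphism of DG operads $g\colon\mathcal A_\infty\to\mathcal O$ with $m_2^g=m_2$ is homotopic to $f$, in the model category of non-symmetric DG operads over $k$ whose weak equivalences are the quasi-isomorphisms and whose fibrations are the degree-wise surjections. -/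

import Mathlib

universe u v w

/-! ## Signs -/

theorem negOne_zpow_congr {k : Type*} [Field k] {a b : ℤ} (h : Even (a - b)) :
    (-1 : k) ^ a = (-1 : k) ^ b := by
  have : a = (a - b) + b := by ring
  rw [this, zpow_add₀ (neg_ne_zero.2 one_ne_zero), h.neg_one_zpow, one_mul]

theorem negOne_zpow_mul {k : Type*} [Field k] (a b : ℤ) :
    (-1 : k) ^ a * (-1 : k) ^ b = (-1 : k) ^ (a + b) :=
  (zpow_add₀ (neg_ne_zero.2 one_ne_zero) a b).symm

/-! ## Non-symmetric DG operads -/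

/-- A non-symmetric DG operad over the field `k`, with differentials raising the degree.
`X n a` is the vector space of operations of arity `n` and degree `a`.  The infinitesimal
composition `x ∘ᵢ y`, for `1 ≤ i ≤ p` where `p` is the arity of `x`, is written
`comp i hi hn hc x y`; the proofs `hn` and `hc` say that the indices of the target are
`n = p + q - 1` and `c = a + b`.  Likewise `d h` goes from degree `a` to degree `b = a + 1`. -/
structure DGOperad (k : Type u) [Field k] where
  X : ℕ → ℤ → Type v
  [addCommGroup : ∀ n a, AddCommGroup (X n a)]
  [module : ∀ n a, Module k (X n a)]
  d : ∀ {n : ℕ} {a b : ℤ}, a + 1 = b → (X n a →ₗ[k] X n b)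
  d_d : ∀ {n : ℕ} {a b c : ℤ} (h : a + 1 = b) (h' : b + 1 = c) (x : X n a), d h' (d h x) = 0
  one : X 1 0
  d_one : ∀ {b : ℤ} (h : 0 + 1 = b), d h one = 0
  comp : ∀ {p q n : ℕ} {a b c : ℤ} (i : ℕ), 1 ≤ i ∧ i ≤ p → p + q = n + 1 → a + b = c →
    (X p a →ₗ[k] X q b →ₗ[k] X n c)
  one_comp : ∀ {q : ℕ} {b : ℤ} (i : ℕ) (hi : 1 ≤ i ∧ i ≤ 1) (hn : 1 + q = q + 1)
    (hc : 0 + b = b) (y : X q b), comp i hi hn hc one y = y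
  comp_one : ∀ {p : ℕ} {a : ℤ} (i : ℕ) (hi : 1 ≤ i ∧ i ≤ p) (hn : p + 1 = p + 1)
    (hc : a + 0 = a) (x : X p a), comp i hi hn hc x one = x
  /-- Sequential composition: `(x ∘ᵢ y) ∘ᵢ₊ⱼ₋₁ z = x ∘ᵢ (y ∘ⱼ z)`. -/
  comp_seq : ∀ {p q r s t n : ℕ} {a b c e f g : ℤ} (i j l : ℕ)
    (hi : 1 ≤ i ∧ i ≤ p) (hj : 1 ≤ j ∧ j ≤ q) (_ : l + 1 = i + j) (hl : 1 ≤ l ∧ l ≤ s)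
    (hs : p + q = s + 1) (he : a + b = e) (hn : s + r = n + 1) (hg : e + c = g)
    (ht : q + r = t + 1) (hf : b + c = f) (hn' : p + t = n + 1) (hg' : a + f = g)
    (x : X p a) (y : X q b) (z : X r c),
    comp l hl hn hg (comp i hi hs he x y) z = comp i hi hn' hg' x (comp j hj ht hf y z)
  /-- Parallel composition: `(x ∘ᵢ y) ∘ⱼ₊|y|₋₁ z = ± (x ∘ⱼ z) ∘ᵢ y` for `i < j`, where
  `|y|` is the arity of `y` and the sign is the Koszul sign of the exchange of `y` and `z`. -/
  comp_par : ∀ {p q r s t n : ℕ} {a b c e f g : ℤ} (i j l : ℕ)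
    (hi : 1 ≤ i ∧ i ≤ p) (hj : 1 ≤ j ∧ j ≤ p) (_ : i < j) (_ : l + 1 = j + q)
    (hl : 1 ≤ l ∧ l ≤ s) (hi' : 1 ≤ i ∧ i ≤ t)
    (hs : p + q = s + 1) (he : a + b = e) (hn : s + r = n + 1) (hg : e + c = g)
    (ht : p + r = t + 1) (hf : a + c = f) (hn' : t + q = n + 1) (hg' : f + b = g)
    (x : X p a) (y : X q b) (z : X r c),
    comp l hl hn hg (comp i hi hs he x y) z =
      (-1 : k) ^ (b * c) • comp i hi' hn' hg' (comp j hj ht hf x z) y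
  /-- Leibniz rule: the infinitesimal compositions are cochain maps. -/
  d_comp : ∀ {p q n : ℕ} {a b c a' b' c' : ℤ} (i : ℕ) (hi : 1 ≤ i ∧ i ≤ p)
    (hn : p + q = n + 1) (hc : a + b = c) (ha : a + 1 = a') (hb : b + 1 = b')
    (hc' : c + 1 = c') (hl : a' + b = c') (hr : a + b' = c') (x : X p a) (y : X q b),
    d hc' (comp i hi hn hc x y) =
      comp i hi hn hl (d ha x) y + (-1 : k) ^ a • comp i hi hn hr x (d hb y)

attribute [instance] DGOperad.addCommGroup DGOperad.module

namespace DGOperad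

variable {k : Type u} [Field k]

/-- A graded operad is a DG operad with vanishing differential. -/
def IsGraded (P : DGOperad.{u, v} k) : Prop :=
  ∀ {n : ℕ} {a b : ℤ} (h : a + 1 = b) (x : P.X n a), P.d h x = 0

/-- Morphisms of DG operads. -/
@[ext]
structure Hom (P : DGOperad.{u, v} k) (Q : DGOperad.{u, w} k) where
  app : ∀ (n : ℕ) (a : ℤ), P.X n a →ₗ[k] Q.X n a
  app_d : ∀ {n : ℕ} {a b : ℤ} (h : a + 1 = b) (x : P.X n a),
    app n b (P.d h x) = Q.d h (app n a x)
  app_one : app 1 0 P.one = Q.one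
  app_comp : ∀ {p q n : ℕ} {a b c : ℤ} (i : ℕ) (hi : 1 ≤ i ∧ i ≤ p) (hn : p + q = n + 1)
    (hc : a + b = c) (x : P.X p a) (y : P.X q b),
    app n c (P.comp i hi hn hc x y) = Q.comp i hi hn hc (app p a x) (app q b y)

/-- The identity morphism. -/
def Hom.id (P : DGOperad.{u, v} k) : Hom P P where
  app _ _ := LinearMap.id
  app_d _ _ := rfl
  app_one := rfl
  app_comp _ _ _ _ _ _ := rfl

/-- `φ.comp ψ` is the composite `φ ∘ ψ`. -/
def Hom.comp {P : DGOperad.{u, v} k} {Q : DGOperad.{u, w} k} {R : DGOperad k}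
    (φ : Hom Q R) (ψ : Hom P Q) : Hom P R where
  app n a := (φ.app n a).comp (ψ.app n a)
  app_d h x := by simp [ψ.app_d, φ.app_d]
  app_one := by simp [ψ.app_one, φ.app_one]
  app_comp i hi hn hc x y := by simp [ψ.app_comp, φ.app_comp]

/-! ## Quasi-isomorphisms and homotopies -/

/-- Cocycles of arity `n` and degree `a`. -/
def Z (P : DGOperad.{u, v} k) (n : ℕ) (a : ℤ) : Submodule k (P.X n a) :=
  LinearMap.ker (P.d (n := n) (rfl : a + 1 = a + 1))

/-- Coboundaries of arity `n` and degree `a`. -/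
def B (P : DGOperad.{u, v} k) (n : ℕ) (a : ℤ) : Submodule k (P.X n a) :=
  LinearMap.range (P.d (n := n) (sub_add_cancel a 1))

/-- The cohomology of the complex of operations of arity `n`, in degree `a`. -/
abbrev H (P : DGOperad.{u, v} k) (n : ℕ) (a : ℤ) : Type v :=
  P.Z n a ⧸ (P.B n a).comap (P.Z n a).subtype

/-- The map induced by a morphism on cocycles. -/
def Hom.mapZ {P : DGOperad.{u, v} k} {Q : DGOperad.{u, w} k} (φ : Hom P Q) (n : ℕ) (a : ℤ) :
    P.Z n a →ₗ[k] Q.Z n a :=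
  (φ.app n a).restrict (fun x hx => by
    have hx' : P.d (rfl : a + 1 = a + 1) x = 0 := hx
    change Q.d (rfl : a + 1 = a + 1) (φ.app n a x) = 0
    rw [← φ.app_d, hx', map_zero])

/-- The map induced by a morphism on cohomology. -/
def Hom.mapH {P : DGOperad.{u, v} k} {Q : DGOperad.{u, w} k} (φ : Hom P Q) (n : ℕ) (a : ℤ) :
    P.H n a →ₗ[k] Q.H n a :=
  Submodule.mapQ _ _ (φ.mapZ n a) (by
    rintro ⟨x, hx⟩ ⟨y, hy⟩
    exact ⟨φ.app n (a - 1) y, by rw [← φ.app_d, hy]; rfl⟩)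

/-- Weak equivalences of DG operads: arity-wise quasi-isomorphisms. -/
def Hom.IsQuasiIso {P : DGOperad.{u, v} k} {Q : DGOperad.{u, w} k} (φ : Hom P Q) : Prop :=
  ∀ (n : ℕ) (a : ℤ), Function.Bijective (φ.mapH n a)

/-- A path object of the DG operad `O`: a factorisation of the diagonal `O → O × O` as a weak
equivalence `s : O → P` followed by a fibration `(p₀, p₁) : P → O × O`, that is, an
arity-wise and degree-wise surjective morphism. -/
structure PathObject (O : DGOperad.{u, v} k) where
  P : DGOperad.{u, w} k
  s : Hom O P
  p₀ : Hom P O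
  p₁ : Hom P O
  p₀_s : p₀.comp s = Hom.id O
  p₁_s : p₁.comp s = Hom.id O
  weakEquiv : s.IsQuasiIso
  fibration : ∀ (n : ℕ) (a : ℤ) (x y : O.X n a), ∃ z : P.X n a,
    p₀.app n a z = x ∧ p₁.app n a z = y

/-- (Right) homotopy of morphisms of DG operads, in the model structure whose weak equivalences
are the quasi-isomorphisms and whose fibrations are the surjections: `f` and `g` are homotopic
if `(f, g) : A → O × O` factors through some path object of `O`.  Every DG operad is fibrant, so
for a cofibrant source `A`, such as the `A∞`-operad, this is the relation of being equal in the
homotopy category, i.e. of lying in the same component of the mapping space. -/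
def Hom.Homotopic {A : DGOperad.{u, w} k} {O : DGOperad.{u, v} k} (f g : Hom A O) : Prop :=
  ∃ (I : PathObject.{u, v, max u v} O) (h : Hom A I.P), I.p₀.comp h = f ∧ I.p₁.comp h = g

/-! ## Operadic suspension -/

/-- The operadic suspension: `susp O` has operations `O(n)[1 - n]` in arity `n`, with the
differential of the shift, and composition twisted by `(-1)^((q-1)(p-i+|x|))` on `x ∘ᵢ y`, where
`x`, `y` have arities `p`, `q` and `|x|` is the degree of `x` in `O`; if `a` is the degree of `x`
in the suspension then `|x| = a + 1 - p`, and the exponent is `(q-1)(a+1-i)`. -/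
def susp (O : DGOperad.{u, v} k) : DGOperad.{u, v} k where
  X n a := O.X n (a + 1 - n)
  d {n a b} h := (-1 : k) ^ (1 - (n : ℤ)) • O.d (n := n) (by omega)
  d_d h h' x := by simp [O.d_d]
  one := O.one
  d_one {b} h := by
    have := O.d_one (b := b + 1 - ((1 : ℕ) : ℤ)) (by omega)
    simpa using this
  comp {p q n a b c} i hi hn hc :=
    (-1 : k) ^ (((q : ℤ) - 1) * (a + 1 - i)) • O.comp i hi hn (by omega)
  one_comp {q b} i hi hn hc y := by
    obtain rfl : i = 1 := by omega
    have := O.one_comp 1 hi hn (zero_add _) y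
    simpa using this
  comp_one {p a} i hi hn hc x := by
    have := O.comp_one i hi hn (add_zero _) x
    simpa using this
  comp_seq {p q r s t n a b c e f g} i j l hi hj hl' hl hs he hn hg ht hf hn' hg' x y z := by
    simp only [LinearMap.smul_apply, map_smul, smul_smul, negOne_zpow_mul]
    rw [O.comp_seq i j l hi hj hl' hl hs _ hn _ ht (f := f + 1 - (t : ℤ)) (by omega) hn' (by omega)]
    congr 1
    apply negOne_zpow_congr
    have h1 : (l : ℤ) = i + j - 1 := by omega
    have h2 : (t : ℤ) = q + r - 1 := by omega
    subst he
    rw [h1, h2]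
    exact ⟨0, by ring⟩
  comp_par {p q r s t n a b c e f g} i j l hi hj hij hl' hl hi' hs he hn hg ht hf hn' hg'
      x y z := by
    simp only [LinearMap.smul_apply, map_smul, smul_smul, negOne_zpow_mul]
    rw [O.comp_par i j l hi hj hij hl' hl hi' hs _ hn _ ht (f := f + 1 - (t : ℤ)) (by omega) hn'
      (by omega), smul_smul, negOne_zpow_mul]
    congr 1
    apply negOne_zpow_congr
    have h1 : (l : ℤ) = j + q - 1 := by omega
    subst he hf
    rw [h1]
    exact ⟨-((q - 1) * c), by ring⟩
  d_comp {p q n a b c a' b' c'} i hi hn hc ha hb hc' hl hr x y := by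
    simp only [LinearMap.smul_apply, map_smul, smul_smul, negOne_zpow_mul]
    rw [O.d_comp i hi hn (a' := a' + 1 - (p : ℤ)) (b' := b' + 1 - (q : ℤ)) _ (by omega)
      (by omega) _ (by omega) (by omega), smul_add, smul_smul, negOne_zpow_mul]
    have h1 : (n : ℤ) = p + q - 1 := by omega
    subst ha
    congr 1
    · congr 1
      apply negOne_zpow_congr
      rw [h1]
      exact ⟨1 - q, by ring⟩
    · congr 1
      apply negOne_zpow_congr
      rw [h1]
      exact ⟨1 - p, by ring⟩

/-! ## Braces, multiplications and the cohomology of an operad with multiplication -/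

/-- The brace `x{y} = ∑ᵢ x ∘ᵢ y`, the sum over `1 ≤ i ≤ p` where `p` is the arity of `x`. -/
def brace (P : DGOperad.{u, v} k) {p q n : ℕ} {a b c : ℤ} (hn : p + q = n + 1) (hc : a + b = c) :
    P.X p a →ₗ[k] P.X q b →ₗ[k] P.X n c :=
  ∑ i : Fin p, P.comp (i.val + 1) ⟨Nat.le_add_left 1 i.val, i.isLt⟩ hn hc

/-- The Gerstenhaber Lie bracket `[x, y] = x{y} - (-1)^(|x||y|) y{x}`, where `|x|` and `|y|` are
the degrees in the operad (the shifted total degrees in the operad complex). -/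
def bracket (P : DGOperad.{u, v} k) {p q n : ℕ} {a b c : ℤ} (hn : p + q = n + 1)
    (hc : a + b = c) : P.X p a →ₗ[k] P.X q b →ₗ[k] P.X n c :=
  P.brace hn hc -
    (-1 : k) ^ (a * b) • (P.brace ((Nat.add_comm q p).trans hn) ((add_comm b a).trans hc)).flip

/-- A multiplication: an operation `m` of arity `2` and degree `1` with `m{m} = 0`. -/
def IsMultiplication (P : DGOperad.{u, v} k) (m : P.X 2 1) : Prop :=
  P.brace (p := 2) (q := 2) (n := 3) (a := 1) (b := 1) (c := 2) rfl rfl m m = 0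

/-- The bidegree `(p, q)` part of the operad complex. -/
abbrev OC (P : DGOperad.{u, v} k) (p : ℕ) (q : ℤ) : Type v := P.X p (p + q - 1)

/-- The differential `[m, -]` of the operad complex. -/
def OC.d (P : DGOperad.{u, v} k) (m : P.X 2 1) (p : ℕ) (q : ℤ) : P.OC p q →ₗ[k] P.OC (p + 1) q :=
  P.bracket (n := p + 1) (by omega) (by push_cast; ring) m

/-- The cocycles of the operad complex. -/
def OZ (P : DGOperad.{u, v} k) (m : P.X 2 1) (p : ℕ) (q : ℤ) : Submodule k (P.OC p q) :=
  LinearMap.ker (OC.d P m p q)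

/-- The coboundaries of the operad complex. -/
def OB (P : DGOperad.{u, v} k) (m : P.X 2 1) : ∀ (p : ℕ) (q : ℤ), Submodule k (P.OC p q)
  | 0, _ => ⊥
  | p + 1, q => LinearMap.range (OC.d P m p q)

/-- The cohomology `H^{p,q}` of the operad complex of an operad with multiplication `m`. -/
abbrev OH (P : DGOperad.{u, v} k) (m : P.X 2 1) (p : ℕ) (q : ℤ) : Type v :=
  P.OZ m p q ⧸ (P.OB m p q).comap (P.OZ m p q).subtype

/-! ## The associative operad -/

/-- The operad of non-unital associative algebras: `k` in each arity `n ≥ 1`, in degree `0`, and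
`0` otherwise; composition is the multiplication of `k`. -/
def Ass (k : Type u) [Field k] : DGOperad.{u, u} k where
  X n a := ↥(if 1 ≤ n ∧ a = 0 then (⊤ : Submodule k k) else ⊥)
  d _ := 0
  d_d _ _ _ := rfl
  one := ⟨1, by simp⟩
  d_one _ := rfl
  comp {p q n a b c} i hi hn hc := LinearMap.mk₂ k
    (fun x y => ⟨x.1 * y.1, by
      obtain ⟨x, hx⟩ := x
      obtain ⟨y, hy⟩ := y
      by_cases h1 : 1 ≤ p ∧ a = 0
      · by_cases h2 : 1 ≤ q ∧ b = 0
        · rw [if_pos (by omega)]; trivial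
        · rw [if_neg h2, Submodule.mem_bot] at hy
          simp [hy]
      · rw [if_neg h1, Submodule.mem_bot] at hx
        simp [hx]⟩)
    (fun _ _ _ => Subtype.ext (by simp [add_mul]))
    (fun _ _ _ => Subtype.ext (by simp [mul_assoc]))
    (fun _ _ _ => Subtype.ext (by simp [mul_add]))
    (fun _ _ _ => Subtype.ext (by simp [mul_left_comm]))
  one_comp _ _ _ _ _ := Subtype.ext (by simp)
  comp_one _ _ _ _ _ := Subtype.ext (by simp)
  comp_seq _ _ _ _ _ _ _ _ _ _ _ _ _ _ _ _ _ _ := Subtype.ext (by simp [mul_assoc])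
  comp_par {p q r s t n a b c e f g} i j l hi hj hij hl' hl hi' hs he hn hg ht hf hn' hg'
      x y z := Subtype.ext (by
    obtain ⟨y, hy⟩ := y
    by_cases h2 : 1 ≤ q ∧ b = 0
    · obtain ⟨-, rfl⟩ := h2
      simp [mul_right_comm]
    · rw [if_neg h2, Submodule.mem_bot] at hy
      simp [hy])
  d_comp _ _ _ _ _ _ _ _ _ _ _ := Subtype.ext (by simp)

/-- The binary product, generating the associative operad. -/
def Ass.μ (k : Type u) [Field k] : (Ass k).X 2 0 := ⟨1, by simp⟩

/-! ## The `A∞`-operad -/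

/-- `A∞`-families in a DG operad `P`: operations `m n` of degree `2 - n` in `P(n)`, i.e. of degree
`1` in the suspension, for `n ≥ 2`, with `d(m n) + ∑_{p + q = n + 1} (m p){m q} = 0` in the
suspension.  Here `p = s + 2` and `q = n - 1 - s`, so that `p, q ≥ 2`. -/
def IsAInf (P : DGOperad.{u, v} k) (m : ∀ n : ℕ, 2 ≤ n → P.susp.X n 1) : Prop :=
  ∀ (n : ℕ) (hn : 2 ≤ n),
    P.susp.d (b := 2) rfl (m n hn) + ∑ s : Fin (n - 2),
      P.susp.brace (n := n) (c := 2) (by omega) rfl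
        (m (s.val + 2) (by omega)) (m (n - 1 - s.val) (by omega)) = 0

namespace AInf

/-- Formal expressions of arity `n` and degree `a` in the generators `m n`, `n ≥ 2`. -/
inductive Pre (k : Type u) : ℕ → ℤ → Type u
  | m (n : ℕ) (hn : 2 ≤ n) : Pre k n (1 + 1 - n)
  | one : Pre k 1 0
  | zero (n : ℕ) (a : ℤ) : Pre k n a
  | add {n : ℕ} {a : ℤ} : Pre k n a → Pre k n a → Pre k n a
  | smul {n : ℕ} {a : ℤ} : k → Pre k n a → Pre k n a
  | d {n : ℕ} {a b : ℤ} (h : a + 1 = b) : Pre k n a → Pre k n b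
  | comp {p q n : ℕ} {a b c : ℤ} (i : ℕ) (hi : 1 ≤ i ∧ i ≤ p) (hn : p + q = n + 1)
      (hc : a + b = c) : Pre k p a → Pre k q b → Pre k n c

/-- Formal finite sums. -/
def Pre.sum {k : Type u} {n : ℕ} {a : ℤ} : ∀ s : ℕ, (Fin s → Pre k n a) → Pre k n a
  | 0, _ => Pre.zero n a
  | s + 1, f => Pre.add (f 0) (Pre.sum s fun i => f i.succ)

/-- The formal expression `(-1)^n ∑ (-1)^((q-1) i) (m p) ∘ᵢ (m q)`, where `p = s + 2` and
`q = n - 1 - s` run over the pairs with `p + q = n + 1` and `p, q ≥ 2`, and `1 ≤ i ≤ p`. -/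
def dm (k : Type u) [Field k] (n : ℕ) : Pre k n (2 + 1 - n) :=
  Pre.smul ((-1 : k) ^ n) (Pre.sum (n - 2) fun s => Pre.sum (s.val + 2) fun i =>
    Pre.smul ((-1 : k) ^ ((n - 1 - s.val - 1) * (i.val + 1)))
      (Pre.comp (i.val + 1) ⟨Nat.le_add_left 1 i.val, i.isLt⟩ (by omega) (by omega)
        (Pre.m (s.val + 2) (by omega)) (Pre.m (n - 1 - s.val) (by omega))))

/-- The smallest equivalence relation on formal expressions which is compatible with all
operations, makes them a DG operad, and identifies `d(m n)` with the expression `dm k n`. -/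
inductive Rel (k : Type u) [Field k] : ∀ {n : ℕ} {a : ℤ}, Pre k n a → Pre k n a → Prop
  | refl {n : ℕ} {a : ℤ} (x : Pre k n a) : Rel k x x
  | symm {n : ℕ} {a : ℤ} {x y : Pre k n a} : Rel k x y → Rel k y x
  | trans {n : ℕ} {a : ℤ} {x y z : Pre k n a} : Rel k x y → Rel k y z → Rel k x z
  | congr_add {n : ℕ} {a : ℤ} {x x' y y' : Pre k n a} :
      Rel k x x' → Rel k y y' → Rel k (x.add y) (x'.add y')
  | congr_smul {n : ℕ} {a : ℤ} (r : k) {x x' : Pre k n a} :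
      Rel k x x' → Rel k (x.smul r) (x'.smul r)
  | congr_d {n : ℕ} {a b : ℤ} (h : a + 1 = b) {x x' : Pre k n a} :
      Rel k x x' → Rel k (x.d h) (x'.d h)
  | congr_comp {p q n : ℕ} {a b c : ℤ} (i : ℕ) (hi : 1 ≤ i ∧ i ≤ p) (hn : p + q = n + 1)
      (hc : a + b = c) {x x' : Pre k p a} {y y' : Pre k q b} :
      Rel k x x' → Rel k y y' → Rel k (Pre.comp i hi hn hc x y) (Pre.comp i hi hn hc x' y')
  | zero_add {n : ℕ} {a : ℤ} (x : Pre k n a) : Rel k ((Pre.zero n a).add x) x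
  | add_comm {n : ℕ} {a : ℤ} (x y : Pre k n a) : Rel k (x.add y) (y.add x)
  | add_assoc {n : ℕ} {a : ℤ} (x y z : Pre k n a) :
      Rel k ((x.add y).add z) (x.add (y.add z))
  | one_smul {n : ℕ} {a : ℤ} (x : Pre k n a) : Rel k (x.smul 1) x
  | zero_smul {n : ℕ} {a : ℤ} (x : Pre k n a) : Rel k (x.smul 0) (Pre.zero n a)
  | mul_smul {n : ℕ} {a : ℤ} (r r' : k) (x : Pre k n a) :
      Rel k (x.smul (r * r')) ((x.smul r').smul r)
  | add_smul {n : ℕ} {a : ℤ} (r r' : k) (x : Pre k n a) :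
      Rel k (x.smul (r + r')) ((x.smul r).add (x.smul r'))
  | smul_add {n : ℕ} {a : ℤ} (r : k) (x y : Pre k n a) :
      Rel k ((x.add y).smul r) ((x.smul r).add (y.smul r))
  | d_add {n : ℕ} {a b : ℤ} (h : a + 1 = b) (x y : Pre k n a) :
      Rel k ((x.add y).d h) ((x.d h).add (y.d h))
  | d_smul {n : ℕ} {a b : ℤ} (h : a + 1 = b) (r : k) (x : Pre k n a) :
      Rel k ((x.smul r).d h) ((x.d h).smul r)
  | comp_add {p q n : ℕ} {a b c : ℤ} (i : ℕ) (hi : 1 ≤ i ∧ i ≤ p) (hn : p + q = n + 1)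
      (hc : a + b = c) (x : Pre k p a) (y y' : Pre k q b) :
      Rel k (Pre.comp i hi hn hc x (y.add y'))
        ((Pre.comp i hi hn hc x y).add (Pre.comp i hi hn hc x y'))
  | add_comp {p q n : ℕ} {a b c : ℤ} (i : ℕ) (hi : 1 ≤ i ∧ i ≤ p) (hn : p + q = n + 1)
      (hc : a + b = c) (x x' : Pre k p a) (y : Pre k q b) :
      Rel k (Pre.comp i hi hn hc (x.add x') y)
        ((Pre.comp i hi hn hc x y).add (Pre.comp i hi hn hc x' y))
  | comp_smul {p q n : ℕ} {a b c : ℤ} (i : ℕ) (hi : 1 ≤ i ∧ i ≤ p) (hn : p + q = n + 1)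
      (hc : a + b = c) (r : k) (x : Pre k p a) (y : Pre k q b) :
      Rel k (Pre.comp i hi hn hc x (y.smul r)) ((Pre.comp i hi hn hc x y).smul r)
  | smul_comp {p q n : ℕ} {a b c : ℤ} (i : ℕ) (hi : 1 ≤ i ∧ i ≤ p) (hn : p + q = n + 1)
      (hc : a + b = c) (r : k) (x : Pre k p a) (y : Pre k q b) :
      Rel k (Pre.comp i hi hn hc (x.smul r) y) ((Pre.comp i hi hn hc x y).smul r)
  | d_d {n : ℕ} {a b c : ℤ} (h : a + 1 = b) (h' : b + 1 = c) (x : Pre k n a) :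
      Rel k ((x.d h).d h') (Pre.zero n c)
  | d_one {b : ℤ} (h : 0 + 1 = b) : Rel k (Pre.one.d h) (Pre.zero 1 b)
  | one_comp {q : ℕ} {b : ℤ} (i : ℕ) (hi : 1 ≤ i ∧ i ≤ 1) (hn : 1 + q = q + 1)
      (hc : 0 + b = b) (y : Pre k q b) : Rel k (Pre.comp i hi hn hc Pre.one y) y
  | comp_one {p : ℕ} {a : ℤ} (i : ℕ) (hi : 1 ≤ i ∧ i ≤ p) (hn : p + 1 = p + 1)
      (hc : a + 0 = a) (x : Pre k p a) : Rel k (Pre.comp i hi hn hc x Pre.one) x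
  | comp_seq {p q r s t n : ℕ} {a b c e f g : ℤ} (i j l : ℕ)
      (hi : 1 ≤ i ∧ i ≤ p) (hj : 1 ≤ j ∧ j ≤ q) (hl' : l + 1 = i + j) (hl : 1 ≤ l ∧ l ≤ s)
      (hs : p + q = s + 1) (he : a + b = e) (hn : s + r = n + 1) (hg : e + c = g)
      (ht : q + r = t + 1) (hf : b + c = f) (hn' : p + t = n + 1) (hg' : a + f = g)
      (x : Pre k p a) (y : Pre k q b) (z : Pre k r c) :
      Rel k (Pre.comp l hl hn hg (Pre.comp i hi hs he x y) z)
        (Pre.comp i hi hn' hg' x (Pre.comp j hj ht hf y z))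
  | comp_par {p q r s t n : ℕ} {a b c e f g : ℤ} (i j l : ℕ)
      (hi : 1 ≤ i ∧ i ≤ p) (hj : 1 ≤ j ∧ j ≤ p) (hij : i < j) (hl' : l + 1 = j + q)
      (hl : 1 ≤ l ∧ l ≤ s) (hi' : 1 ≤ i ∧ i ≤ t)
      (hs : p + q = s + 1) (he : a + b = e) (hn : s + r = n + 1) (hg : e + c = g)
      (ht : p + r = t + 1) (hf : a + c = f) (hn' : t + q = n + 1) (hg' : f + b = g)
      (x : Pre k p a) (y : Pre k q b) (z : Pre k r c) :
      Rel k (Pre.comp l hl hn hg (Pre.comp i hi hs he x y) z)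
        (Pre.smul ((-1 : k) ^ (b * c)) (Pre.comp i hi' hn' hg' (Pre.comp j hj ht hf x z) y))
  | d_comp {p q n : ℕ} {a b c a' b' c' : ℤ} (i : ℕ) (hi : 1 ≤ i ∧ i ≤ p)
      (hn : p + q = n + 1) (hc : a + b = c) (ha : a + 1 = a') (hb : b + 1 = b')
      (hc' : c + 1 = c') (hl : a' + b = c') (hr : a + b' = c') (x : Pre k p a) (y : Pre k q b) :
      Rel k ((Pre.comp i hi hn hc x y).d hc')
        ((Pre.comp i hi hn hl (x.d ha) y).add
          (Pre.smul ((-1 : k) ^ a) (Pre.comp i hi hn hr x (y.d hb))))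
  | d_m (n : ℕ) (hn : 2 ≤ n) (h : (1 + 1 - n : ℤ) + 1 = 2 + 1 - n) :
      Rel k ((Pre.m n hn).d h) (dm k n)

/-- Formal expressions modulo the relations. -/
def setoid (k : Type u) [Field k] (n : ℕ) (a : ℤ) : Setoid (Pre k n a) where
  r := Rel k
  iseqv := ⟨Rel.refl, Rel.symm, Rel.trans⟩

/-- The operations of arity `n` and degree `a` of the `A∞`-operad. -/
def X (k : Type u) [Field k] (n : ℕ) (a : ℤ) : Type u := Quotient (setoid k n a)

/-- The class of a formal expression. -/
def mk {k : Type u} [Field k] {n : ℕ} {a : ℤ} (x : Pre k n a) : X k n a :=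
  Quotient.mk (setoid k n a) x

theorem mk_eq {k : Type u} [Field k] {n : ℕ} {a : ℤ} {x y : Pre k n a} (h : Rel k x y) :
    mk x = mk y := Quotient.sound h

instance (k : Type u) [Field k] (n : ℕ) (a : ℤ) : Add (X k n a) :=
  ⟨Quotient.map₂ Pre.add fun _ _ h _ _ h' => Rel.congr_add h h'⟩

instance (k : Type u) [Field k] (n : ℕ) (a : ℤ) : Zero (X k n a) := ⟨mk (Pre.zero n a)⟩

instance (k : Type u) [Field k] (n : ℕ) (a : ℤ) : Neg (X k n a) :=
  ⟨Quotient.map (Pre.smul (-1)) fun _ _ h => Rel.congr_smul _ h⟩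

instance (k : Type u) [Field k] (n : ℕ) (a : ℤ) : AddCommGroup (X k n a) where
  add_assoc := by rintro ⟨x⟩ ⟨y⟩ ⟨z⟩; exact mk_eq (Rel.add_assoc x y z)
  zero_add := by rintro ⟨x⟩; exact mk_eq (Rel.zero_add x)
  add_zero := by rintro ⟨x⟩; exact mk_eq ((Rel.add_comm _ _).trans (Rel.zero_add x))
  add_comm := by rintro ⟨x⟩ ⟨y⟩; exact mk_eq (Rel.add_comm x y)
  neg_add_cancel := by
    rintro ⟨x⟩
    refine mk_eq (((Rel.refl _).congr_add (Rel.one_smul x).symm).trans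
      ((Rel.add_smul (-1) 1 x).symm.trans ?_))
    rw [neg_add_cancel]
    exact Rel.zero_smul x
  nsmul := nsmulRec
  zsmul := zsmulRec

theorem mk_add {k : Type u} [Field k] {n : ℕ} {a : ℤ} (x y : Pre k n a) :
    mk (x.add y) = mk x + mk y := rfl

theorem mk_zero {k : Type u} [Field k] (n : ℕ) (a : ℤ) :
    mk (Pre.zero n a : Pre k n a) = 0 := rfl

instance (k : Type u) [Field k] (n : ℕ) (a : ℤ) : Module k (X k n a) where
  smul r := Quotient.map (Pre.smul r) fun _ _ h => Rel.congr_smul _ h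
  one_smul := by rintro ⟨x⟩; exact mk_eq (Rel.one_smul x)
  mul_smul := by rintro r r' ⟨x⟩; exact mk_eq (Rel.mul_smul r r' x)
  add_smul := by rintro r r' ⟨x⟩; exact mk_eq (Rel.add_smul r r' x)
  smul_add := by rintro r ⟨x⟩ ⟨y⟩; exact mk_eq (Rel.smul_add r x y)
  zero_smul := by rintro ⟨x⟩; exact mk_eq (Rel.zero_smul x)
  smul_zero := by
    intro r
    refine mk_eq ((Rel.congr_smul r (Rel.zero_smul (Pre.zero n a)).symm).trans
      ((Rel.mul_smul r 0 _).symm.trans ?_))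
    rw [mul_zero]
    exact Rel.zero_smul _

theorem mk_smul {k : Type u} [Field k] {n : ℕ} {a : ℤ} (r : k) (x : Pre k n a) :
    mk (x.smul r) = r • mk x := rfl

theorem mk_sum {k : Type u} [Field k] {n : ℕ} {a : ℤ} (s : ℕ) (f : Fin s → Pre k n a) :
    mk (Pre.sum s f) = ∑ i, mk (f i) := by
  induction s with
  | zero => rfl
  | succ s ih => rw [Fin.sum_univ_succ, ← ih]; rfl

end AInf

/-- The `A∞`-operad: the DG operad generated by operations `m n` of arity `n` and degree `2 - n`,
for `n ≥ 2`, subject to `d(m n) = (-1)^n ∑_{p + q = n + 1} ∑ᵢ (-1)^((q-1) i) (m p) ∘ᵢ (m q)`. -/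
def AInf (k : Type u) [Field k] : DGOperad.{u, u} k where
  X := AInf.X k
  d h :=
    { toFun := Quotient.map (AInf.Pre.d h) fun _ _ h' => AInf.Rel.congr_d h h'
      map_add' := by rintro ⟨x⟩ ⟨y⟩; exact AInf.mk_eq (AInf.Rel.d_add h x y)
      map_smul' := by rintro r ⟨x⟩; exact AInf.mk_eq (AInf.Rel.d_smul h r x) }
  d_d := by rintro n a b c h h' ⟨x⟩; exact AInf.mk_eq (AInf.Rel.d_d h h' x)
  one := AInf.mk AInf.Pre.one
  d_one h := AInf.mk_eq (AInf.Rel.d_one h)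
  comp i hi hn hc := LinearMap.mk₂ k
    (Quotient.map₂ (AInf.Pre.comp i hi hn hc) fun _ _ h _ _ h' =>
      AInf.Rel.congr_comp i hi hn hc h h')
    (by rintro ⟨x⟩ ⟨x'⟩ ⟨y⟩; exact AInf.mk_eq (AInf.Rel.add_comp i hi hn hc x x' y))
    (by rintro r ⟨x⟩ ⟨y⟩; exact AInf.mk_eq (AInf.Rel.smul_comp i hi hn hc r x y))
    (by rintro ⟨x⟩ ⟨y⟩ ⟨y'⟩; exact AInf.mk_eq (AInf.Rel.comp_add i hi hn hc x y y'))
    (by rintro r ⟨x⟩ ⟨y⟩; exact AInf.mk_eq (AInf.Rel.comp_smul i hi hn hc r x y))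
  one_comp := by rintro q b i hi hn hc ⟨y⟩; exact AInf.mk_eq (AInf.Rel.one_comp i hi hn hc y)
  comp_one := by rintro p a i hi hn hc ⟨x⟩; exact AInf.mk_eq (AInf.Rel.comp_one i hi hn hc x)
  comp_seq := by
    rintro p q r s t n a b c e f g i j l hi hj hl' hl hs he hn hg ht hf hn' hg' ⟨x⟩ ⟨y⟩ ⟨z⟩
    exact AInf.mk_eq
      (AInf.Rel.comp_seq i j l hi hj hl' hl hs he hn hg ht hf hn' hg' x y z)
  comp_par := by
    rintro p q r s t n a b c e f g i j l hi hj hij hl' hl hi' hs he hn hg ht hf hn' hg'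
      ⟨x⟩ ⟨y⟩ ⟨z⟩
    exact AInf.mk_eq
      (AInf.Rel.comp_par i j l hi hj hij hl' hl hi' hs he hn hg ht hf hn' hg' x y z)
  d_comp := by
    rintro p q n a b c a' b' c' i hi hn hc ha hb hc' hl hr ⟨x⟩ ⟨y⟩
    exact AInf.mk_eq (AInf.Rel.d_comp i hi hn hc ha hb hc' hl hr x y)

namespace AInf

/-- The generators of the `A∞`-operad, as elements of degree `1` of its suspension. -/
def m (k : Type u) [Field k] (n : ℕ) (hn : 2 ≤ n) : (AInf k).susp.X n 1 := mk (Pre.m n hn)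

/-- The defining equation of `A∞`-families, written in the operad itself. -/
theorem isAInf_iff (P : DGOperad.{u, v} k) (m : ∀ n : ℕ, 2 ≤ n → P.susp.X n 1) :
    IsAInf P m ↔ ∀ (n : ℕ) (hn : 2 ≤ n),
      (P.d (by omega) (show P.X n (1 + 1 - n) from m n hn) : P.X n (2 + 1 - n)) =
        (-1 : k) ^ n • ∑ s : Fin (n - 2), ∑ i : Fin (s.val + 2),
          (-1 : k) ^ ((n - 1 - s.val - 1) * (i.val + 1)) •
            P.comp (i.val + 1) ⟨Nat.le_add_left 1 i.val, i.isLt⟩ (by omega) (by omega)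
              (show P.X (s.val + 2) (1 + 1 - (s.val + 2 : ℕ)) from m (s.val + 2) (by omega))
              (show P.X (n - 1 - s.val) (1 + 1 - (n - 1 - s.val : ℕ)) from
                m (n - 1 - s.val) (by omega)) := by
  refine forall₂_congr fun n hn => ?_
  have hsum : (∑ s : Fin (n - 2), P.susp.brace (n := n) (c := 2) (by omega) rfl
        (m (s.val + 2) (by omega)) (m (n - 1 - s.val) (by omega)) : P.susp.X n 2) =
      (show P.X n (2 + 1 - n) from ∑ s : Fin (n - 2), ∑ i : Fin (s.val + 2),
          (-1 : k) ^ ((n - 1 - s.val - 1) * (i.val + 1)) •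
            P.comp (i.val + 1) ⟨Nat.le_add_left 1 i.val, i.isLt⟩ (by omega) (by omega)
              (show P.X (s.val + 2) (1 + 1 - (s.val + 2 : ℕ)) from m (s.val + 2) (by omega))
              (show P.X (n - 1 - s.val) (1 + 1 - (n - 1 - s.val : ℕ)) from
                m (n - 1 - s.val) (by omega))) := by
    refine Finset.sum_congr rfl fun s _ => ?_
    simp only [brace, LinearMap.sum_apply]
    refine Finset.sum_congr rfl fun i _ => ?_
    change (-1 : k) ^ ((((n - 1 - s.val : ℕ) : ℤ) - 1) * (1 + 1 - ((i.val + 1 : ℕ) : ℤ))) •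
      (_ : P.X n (2 + 1 - n)) = _
    congr 1
    rw [← zpow_natCast]
    apply negOne_zpow_congr
    have h1 : ((n - 1 - s.val - 1 : ℕ) : ℤ) = ((n - 1 - s.val : ℕ) : ℤ) - 1 := by omega
    push_cast [h1]
    exact ⟨-((((n - 1 - s.val : ℕ) : ℤ) - 1) * i.val), by ring⟩
  rw [hsum]
  have hs : (-1 : k) ^ n * (-1 : k) ^ (1 - (n : ℤ)) = -1 := by
    rw [← zpow_natCast, negOne_zpow_mul]
    simp
  have hs' : (-1 : k) ^ n * (-1 : k) ^ n = 1 := by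
    rw [← mul_pow]; simp
  change (-1 : k) ^ (1 - (n : ℤ)) • (P.d (by omega) (show P.X n (1 + 1 - n) from m n hn) :
    P.X n (2 + 1 - n)) + _ = (0 : P.X n (2 + 1 - n)) ↔ _
  constructor
  · intro h
    have := congrArg (fun x => (-1 : k) ^ n • x) h
    simp only [smul_add, smul_smul, hs, smul_zero, neg_smul, one_smul] at this
    exact (neg_add_eq_zero.1 this)
  · intro h
    have hs'' : (-1 : k) ^ (1 - (n : ℤ)) * (-1 : k) ^ n = -1 := by rw [mul_comm, hs]
    rw [h, smul_smul, hs'']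
    simp

/-- The generators form an `A∞`-family. -/
theorem isAInf_m (k : Type u) [Field k] : IsAInf (AInf k) (m k) := by
  rw [isAInf_iff]
  intro n hn
  refine (mk_eq (Rel.d_m n hn (by omega))).trans ?_
  rw [dm, mk_smul, mk_sum]
  congr 1
  refine Finset.sum_congr rfl fun s _ => ?_
  rw [mk_sum]
  rfl

/-- The value of a formal expression on a family of operations. -/
def eval {P : DGOperad.{u, v} k} (M : ∀ n : ℕ, 2 ≤ n → P.susp.X n 1) :
    ∀ {n : ℕ} {a : ℤ}, Pre k n a → P.X n a
  | _, _, .m n hn => M n hn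
  | _, _, .one => P.one
  | _, _, .zero _ _ => 0
  | _, _, .add x y => eval M x + eval M y
  | _, _, .smul r x => r • eval M x
  | _, _, .d h x => P.d h (eval M x)
  | _, _, .comp i hi hn hc x y => P.comp i hi hn hc (eval M x) (eval M y)

theorem eval_sum {P : DGOperad.{u, v} k} (M : ∀ n : ℕ, 2 ≤ n → P.susp.X n 1)
    {n : ℕ} {a : ℤ} (s : ℕ) (f : Fin s → Pre k n a) :
    eval M (Pre.sum s f) = ∑ i, eval M (f i) := by
  induction s with
  | zero => rfl
  | succ s ih => rw [Fin.sum_univ_succ, ← ih]; rfl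

theorem eval_rel {P : DGOperad.{u, v} k} {M : ∀ n : ℕ, 2 ≤ n → P.susp.X n 1}
    (hM : IsAInf P M) {n : ℕ} {a : ℤ} {x y : Pre k n a} (h : Rel k x y) :
    eval M x = eval M y := by
  induction h with
  | refl => rfl
  | symm _ ih => exact ih.symm
  | trans _ _ ih ih' => exact ih.trans ih'
  | congr_add _ _ ih ih' => simp only [eval, ih, ih']
  | congr_smul r _ ih => simp only [eval, ih]
  | congr_d h _ ih => simp only [eval, ih]
  | congr_comp i hi hn hc _ _ ih ih' => simp only [eval, ih, ih']
  | zero_add => simp only [eval, _root_.zero_add]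
  | add_comm => simp only [eval, _root_.add_comm]
  | add_assoc => simp only [eval, _root_.add_assoc]
  | one_smul => simp only [eval, _root_.one_smul]
  | zero_smul => simp only [eval, _root_.zero_smul]
  | mul_smul => simp only [eval, SemigroupAction.mul_smul]
  | add_smul => simp only [eval, _root_.add_smul]
  | smul_add => simp only [eval, _root_.smul_add]
  | d_add => simp only [eval, map_add]
  | d_smul => simp only [eval, map_smul]
  | comp_add => simp only [eval, map_add]
  | add_comp => simp only [eval, map_add, LinearMap.add_apply]
  | comp_smul => simp only [eval, map_smul]
  | smul_comp => simp only [eval, map_smul, LinearMap.smul_apply]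
  | d_d => exact P.d_d _ _ _
  | d_one => exact P.d_one _
  | one_comp => exact P.one_comp _ _ _ _ _
  | comp_one => exact P.comp_one _ _ _ _ _
  | comp_seq i j l hi hj hl' hl hs he hn hg ht hf hn' hg' x y z =>
    exact P.comp_seq i j l hi hj hl' hl hs he hn hg ht hf hn' hg' _ _ _
  | comp_par i j l hi hj hij hl' hl hi' hs he hn hg ht hf hn' hg' x y z =>
    exact P.comp_par i j l hi hj hij hl' hl hi' hs he hn hg ht hf hn' hg' _ _ _
  | d_comp i hi hn hc ha hb hc' hl hr x y =>
    exact P.d_comp i hi hn hc ha hb hc' hl hr _ _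
  | d_m n hn h =>
    have := (isAInf_iff P M).1 hM n hn
    simp only [eval, dm, eval_sum]
    exact this

/-- The morphism from the `A∞`-operad given by an `A∞`-family. -/
def lift {P : DGOperad.{u, v} k} (M : ∀ n : ℕ, 2 ≤ n → P.susp.X n 1) (hM : IsAInf P M) :
    Hom (AInf k) P where
  app n a :=
    { toFun := Quotient.lift (eval M) fun _ _ h => eval_rel hM h
      map_add' := by rintro ⟨x⟩ ⟨y⟩; rfl
      map_smul' := by rintro r ⟨x⟩; rfl }
  app_d := by rintro n a b h ⟨x⟩; rfl
  app_one := rfl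
  app_comp := by rintro p q n a b c i hi hn hc ⟨x⟩ ⟨y⟩; rfl

end AInf

/-- The operation `m n` underlying a morphism `f : A∞ → O`, as an element of `O(n)` of degree
`2 - n`, i.e. of degree `1` in `susp O`, i.e. of bidegree `(n, 2 - n)` in the operad complex of
`susp O`. -/
def Hom.op {O : DGOperad.{u, v} k} (f : Hom (AInf k) O) (n : ℕ) (hn : 2 ≤ n) : O.susp.X n 1 :=
  f.app n (1 + 1 - n) (AInf.m k n hn)

namespace AInf

theorem lift_op {P : DGOperad.{u, v} k} (M : ∀ n : ℕ, 2 ≤ n → P.susp.X n 1) (hM : IsAInf P M)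
    (n : ℕ) (hn : 2 ≤ n) : (lift M hM).op n hn = M n hn := rfl

/-- The family of operations in the associative operad given by the binary product. -/
def assFamily (k : Type u) [Field k] : ∀ n : ℕ, 2 ≤ n → (Ass k).susp.X n 1
  | 2, _ => Ass.μ k
  | _ + 3, _ => 0

theorem isAInf_assFamily (k : Type u) [Field k] : IsAInf (Ass k) (assFamily k) := by
  rw [isAInf_iff]
  intro n hn
  by_cases h3 : n = 3
  · subst h3
    have key : ∀ c : (Ass k).X 3 (2 + 1 - (3 : ℕ)),
        0 = (-1 : k) ^ 3 • ((-1 : k) ^ ((2 - 1) * (0 + 1)) • c +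
          (-1 : k) ^ ((2 - 1) * (1 + 1)) • c) := by
      intro c
      simp
    change (0 : (Ass k).X 3 (2 + 1 - (3 : ℕ))) = (-1 : k) ^ 3 • ∑ s : Fin 1, _
    rw [Fin.sum_univ_one]
    change (0 : (Ass k).X 3 (2 + 1 - (3 : ℕ))) = (-1 : k) ^ 3 • ∑ s : Fin 2, _
    rw [Fin.sum_univ_two]
    exact key _
  · have hX : ∀ x y : (Ass k).X n (2 + 1 - n), x = y := by
      rintro ⟨x, hx⟩ ⟨y, hy⟩
      rw [if_neg (by omega), Submodule.mem_bot] at hx hy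
      exact Subtype.ext (hx.trans hy.symm)
    exact hX _ _

/-- The canonical morphism `A∞ → Ass`, given by the binary product `m 2 = μ` and `m n = 0` for
`n ≥ 3`. -/
def toAss (k : Type u) [Field k] : Hom (AInf k) (Ass k) :=
  lift (assFamily k) (isAInf_assFamily k)

end AInf

end DGOperad

/-! A morphism out of the `A∞`-operad is a family of operations of degree 1 in the suspension with
vanishing curvature `dh + h{h}` (`isAInf_iff_curv`). Existence and uniqueness of `f` are then
immediate: only the arity 3 equation for the binary operation has content, and the generators
determine a morphism. In `O` that equation says that the binary operation is associative, so its
iterated products define the morphism from `Ass`.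

A homotopy from `g` to `f` is a family of curvature zero in a path object with prescribed ends.
Tensoring `O` with the cochains of an interval violates the parallel axiom, because these cochains
are not commutative, and `k` may have any characteristic. Since operads here are non-symmetric,
planar order can replace commutativity. In arity `n` take `O(n)`-valued cochains on an interval with
vertices `0, …, n + 1`, where input `i` sits at vertex `i`. Composition at `i` runs through the
interval of the inner operation when the outer one reaches vertex `i`. A 1-cochain is recorded by
its primitive vanishing at vertex 0, and the cohomology class of a 1-cochain is the value of that
primitive at the last vertex, `Path.top`.

The family `h` is built by obstruction theory (`Path.Approx.exists_succ`). If the curvature vanishes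
through arity `n + 1`, the Bianchi identity `d_curv` makes the curvature in arity `n + 2` a cocycle.
It vanishes at the initial vertex, where `h` restricts to `g`, hence at all vertices, and its only
invariant is its `top`, of bidegree `(n + 2, -n)`. The Bianchi identity one arity higher says that
this `top` is a cocycle for `[m₂, -]` (`Path.Approx.bracket_top`), so by hypothesis it equals `[m₂,
δ]`. Changing `h` in arity `n + 1` by a 1-cochain with `top` equal to `-δ` kills the obstruction,
and a change in arity `n + 2` then kills the curvature there. Each component of `h` eventually
stabilises, and the limit is the homotopy. -/

namespace DGOperad

variable {k : Type u} [Field k]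

/-! ### The brace as a graded pre-Lie product. -/

section Star

variable (Q : DGOperad.{u, v} k)

/-- The brace, extended by zero to target arities that do not match. -/
def braceT (p q n : ℕ) {a b c : ℤ} (hc : a + b = c) : Q.X p a →ₗ[k] Q.X q b →ₗ[k] Q.X n c :=
  if hn : p + q = n + 1 then Q.brace hn hc else 0

theorem braceT_of_eq {p q n : ℕ} {a b c : ℤ} (hc : a + b = c) (hn : p + q = n + 1) :
    Q.braceT p q n hc = Q.brace hn hc := dif_pos hn

theorem braceT_of_ne {p q n : ℕ} {a b c : ℤ} (hc : a + b = c) (hn : p + q ≠ n + 1) :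
    Q.braceT p q n hc = 0 := dif_neg hn

theorem brace_apply {p q n : ℕ} {a b c : ℤ} (hn : p + q = n + 1) (hc : a + b = c)
    (x : Q.X p a) (y : Q.X q b) :
    Q.brace hn hc x y =
      ∑ i : Fin p, Q.comp (i.val + 1) ⟨Nat.le_add_left 1 i.val, i.isLt⟩ hn hc x y := by
  simp [brace]

theorem d_brace {p q n : ℕ} {a b c a' b' c' : ℤ} (hn : p + q = n + 1) (hc : a + b = c)
    (ha : a + 1 = a') (hb : b + 1 = b') (hc' : c + 1 = c') (hl : a' + b = c') (hr : a + b' = c')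
    (x : Q.X p a) (y : Q.X q b) :
    Q.d hc' (Q.brace hn hc x y) =
      Q.brace hn hl (Q.d ha x) y + (-1 : k) ^ a • Q.brace hn hr x (Q.d hb y) := by
  simp only [brace_apply, map_sum, Finset.smul_sum, ← Finset.sum_add_distrib]
  exact Finset.sum_congr rfl fun i _ => Q.d_comp _ _ hn hc ha hb hc' hl hr x y

theorem d_braceT {p q n : ℕ} {a b c a' b' c' : ℤ} (hc : a + b = c)
    (ha : a + 1 = a') (hb : b + 1 = b') (hc' : c + 1 = c') (hl : a' + b = c') (hr : a + b' = c')
    (x : Q.X p a) (y : Q.X q b) :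
    Q.d hc' (Q.braceT p q n hc x y) =
      Q.braceT p q n hl (Q.d ha x) y + (-1 : k) ^ a • Q.braceT p q n hr x (Q.d hb y) := by
  by_cases hn : p + q = n + 1
  · simp only [braceT_of_eq _ _ hn]
    exact Q.d_brace hn hc ha hb hc' hl hr x y
  · simp [braceT_of_ne _ _ hn]

/-- The composites `(x ∘ᵢ y) ∘ⱼ₊|y|₋₁ z` with `i < j` that occur in `(x{y}){z}`, summed. -/
def parSum (p q r n : ℕ) {a b c e g : ℤ} (he : a + b = e) (hg : e + c = g)
    (x : Q.X p a) (y : Q.X q b) (z : Q.X r c) : Q.X n g :=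
  ∑ i ∈ Finset.range p, ∑ j ∈ Finset.range p,
    if h : p + q + r = n + 2 ∧ i < j ∧ j < p then
      Q.comp (p := p + q - 1) (j + q) (by omega) (by omega) hg
        (Q.comp (i + 1) (by omega) (by omega) he x y) z
    else 0

theorem sum_range_three {M : Type*} [AddCommMonoid M] (f : ℕ → M) (i q s : ℕ) (h : i + q ≤ s) :
    ∑ l ∈ Finset.range s, f l = ∑ l ∈ Finset.range i, f l + ∑ j ∈ Finset.range q, f (i + j) +
      ∑ j ∈ Finset.range (s - (i + q)), f (i + q + j) := by
  obtain ⟨t, rfl⟩ := Nat.exists_eq_add_of_le h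
  rw [Finset.sum_range_add, Finset.sum_range_add, Nat.add_sub_cancel_left]

theorem sum_range_ite_lt {M : Type*} [AddCommMonoid M] (f : ℕ → M) (i p : ℕ) (h : i < p) :
    ∑ j ∈ Finset.range (p - (i + 1)), f (i + 1 + j) =
      ∑ j ∈ Finset.range p, if i < j then f j else 0 := by
  obtain ⟨t, rfl⟩ := Nat.exists_eq_add_of_le (show i + 1 ≤ p from h)
  rw [Finset.sum_range_add (n := i + 1), Nat.add_sub_cancel_left,
    Finset.sum_eq_zero (s := Finset.range (i + 1)), zero_add]
  · exact Finset.sum_congr rfl fun j _ => (if_pos (by omega)).symm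
  · intro j hj
    rw [Finset.mem_range] at hj
    exact if_neg (by omega)

theorem sum_range_ite_gt {M : Type*} [AddCommMonoid M] (f : ℕ → M) (i p : ℕ) (h : i < p) :
    ∑ j ∈ Finset.range i, f j = ∑ j ∈ Finset.range p, if j < i then f j else 0 := by
  obtain ⟨t, rfl⟩ := Nat.exists_eq_add_of_le h.le
  rw [Finset.sum_range_add (n := i), Finset.sum_eq_zero (s := Finset.range t), add_zero]
  · refine Finset.sum_congr rfl fun j hj => (if_pos (Finset.mem_range.1 hj)).symm
  · intro j hj
    exact if_neg (by omega)

/-- The brace is a graded pre-Lie product. -/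
theorem brace_brace {p q r s t n : ℕ} {a b c e f e' g : ℤ}
    (hs : p + q = s + 1) (he : a + b = e) (hn : s + r = n + 1) (hg : e + c = g)
    (ht : q + r = t + 1) (hf : b + c = f) (hn' : p + t = n + 1) (hg' : a + f = g)
    (he' : a + c = e') (hg'' : e' + b = g)
    (x : Q.X p a) (y : Q.X q b) (z : Q.X r c) :
    Q.brace hn hg (Q.brace hs he x y) z = Q.brace hn' hg' x (Q.brace ht hf y z) +
      Q.parSum p q r n he hg x y z + (-1 : k) ^ (b * c) • Q.parSum p r q n he' hg'' x z y := by
  -- With slots counted from 0, the slots `l` of `x ∘ᵢ y` with `i ≤ l < i + q` are inputs of `y` and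
  -- the others are inputs of `x`. The middle block is sequential, the block after it is the first
  -- parallel sum, and the block before it becomes the second one by the parallel axiom.
  let G (i l : ℕ) : Q.X n g := if h : i < p ∧ l < s then
    Q.comp (l + 1) ⟨by omega, h.2⟩ hn hg (Q.comp (i + 1) ⟨by omega, h.1⟩ hs he x y) z else 0
  have hL : Q.brace hn hg (Q.brace hs he x y) z =
      ∑ i ∈ Finset.range p, ∑ l ∈ Finset.range s, G i l := by
    simp only [brace_apply, map_sum, LinearMap.sum_apply]
    rw [← Fin.sum_univ_eq_sum_range (fun i => ∑ l ∈ Finset.range s, G i l)]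
    refine Finset.sum_congr rfl fun i _ => ?_
    rw [← Fin.sum_univ_eq_sum_range (fun l => G i l)]
    refine Finset.sum_congr rfl fun l _ => ?_
    refine Eq.trans ?_ (dif_pos (show i.val < p ∧ l.val < s from ⟨i.2, l.2⟩)).symm
    rfl
  have hR : Q.brace hn' hg' x (Q.brace ht hf y z) =
      ∑ i ∈ Finset.range p, ∑ j ∈ Finset.range q, G i (i + j) := by
    simp only [brace_apply, map_sum]
    rw [Finset.sum_comm, ← Fin.sum_univ_eq_sum_range (fun i => ∑ j ∈ Finset.range q, G i (i + j))]
    refine Finset.sum_congr rfl fun i _ => ?_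
    rw [← Fin.sum_univ_eq_sum_range (fun j => G i (i + j))]
    refine Finset.sum_congr rfl fun j _ => ?_
    have hi := i.2
    have hj := j.2
    refine Eq.trans ?_ (dif_pos ⟨i.2, by omega⟩).symm
    exact (Q.comp_seq _ _ _ _ _ (by omega) _ hs he hn hg ht hf hn' hg' x y z).symm
  have hS : Q.parSum p q r n he hg x y z = ∑ i ∈ Finset.range p,
      ∑ j ∈ Finset.range (s - (i + q)), G i (i + q + j) := by
    refine Finset.sum_congr rfl fun i hi => ?_
    rw [Finset.mem_range] at hi
    obtain rfl : s = p + q - 1 := by omega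
    have h1 := sum_range_ite_lt (fun j => G i (j + q - 1)) i p hi
    rw [show p + q - 1 - (i + q) = p - (i + 1) by omega]
    refine Eq.trans ?_ (h1.symm.trans (Finset.sum_congr rfl fun j _ => ?_))
    · refine Finset.sum_congr rfl fun j hj => ?_
      rw [Finset.mem_range] at hj
      by_cases hij : i < j
      · rw [dif_pos (by omega), if_pos hij]
        refine Eq.trans ?_ (dif_pos (by omega)).symm
        congr 2
        simp only [show j + q - 1 + 1 = j + q by omega]
      · rw [dif_neg (by omega), if_neg hij]
    · congr 1; omega
  have hS' : (-1 : k) ^ (b * c) • Q.parSum p r q n he' hg'' x z y = ∑ i ∈ Finset.range p,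
      ∑ l ∈ Finset.range i, G i l := by
    rw [parSum, Finset.sum_comm, Finset.smul_sum]
    refine Finset.sum_congr rfl fun i hi => ?_
    rw [Finset.mem_range] at hi
    rw [sum_range_ite_gt _ i p hi, Finset.smul_sum]
    refine Finset.sum_congr rfl fun j hj => ?_
    rw [Finset.mem_range] at hj
    by_cases hij : j < i
    · rw [dif_pos (by omega), if_pos hij]
      refine Eq.trans ?_ (dif_pos (by omega)).symm
      rw [Q.comp_par (j + 1) (i + 1) (i + r) _ (by omega) (by omega) (by omega) _ (by omega)
        _ he' _ hg'' hs he hn hg x z y, smul_smul, negOne_zpow_mul, mul_comm c b,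
        Even.neg_one_zpow ⟨b * c, rfl⟩, one_smul]
    · rw [dif_neg (by omega), if_neg hij, smul_zero]
  rw [hL, hR, hS, hS', ← Finset.sum_add_distrib, ← Finset.sum_add_distrib]
  refine Finset.sum_congr rfl fun i hi => ?_
  rw [Finset.mem_range] at hi
  rw [sum_range_three _ i q s (by omega)]
  abel

end Star

/-! ### Families of operations, curvature and the Bianchi identity. -/

section Families

variable (Q : DGOperad.{u, v} k)

/-- The product of families of operations given by the braces. -/
def star {a b c : ℤ} (hc : a + b = c) (x : ∀ n, Q.X n a) (y : ∀ n, Q.X n b) (n : ℕ) : Q.X n c :=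
  ∑ p ∈ Finset.range (n + 2), ∑ q ∈ Finset.range (n + 2), Q.braceT p q n hc (x p) (y q)

variable {Q}

/-- Nothing new contributes, since `p + q = n + 1` bounds both arities. A common larger range lets
the sums in iterated products be exchanged. -/
theorem star_eq_sum_range {a b c : ℤ} (hc : a + b = c) (x : ∀ n, Q.X n a) (y : ∀ n, Q.X n b)
    {n N : ℕ} (hN : n + 2 ≤ N) :
    Q.star hc x y n =
      ∑ p ∈ Finset.range N, ∑ q ∈ Finset.range N, Q.braceT p q n hc (x p) (y q) := by
  have hsub : Finset.range (n + 2) ⊆ Finset.range N := Finset.range_mono hN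
  rw [star, ← Finset.sum_subset hsub]
  · refine Finset.sum_congr rfl fun p _ => Finset.sum_subset hsub fun q _ hq => ?_
    rw [Finset.mem_range] at hq
    rw [Q.braceT_of_ne hc (by omega)]
    rfl
  · intro p _ hp
    rw [Finset.mem_range] at hp
    refine Finset.sum_eq_zero fun q _ => ?_
    rw [Q.braceT_of_ne hc (by omega)]
    rfl

theorem star_eq_zero {a b c : ℤ} (hc : a + b = c) {x : ∀ n, Q.X n a} {y : ∀ n, Q.X n b}
    {n : ℕ} (h : ∀ p q, p + q = n + 1 → x p = 0 ∨ y q = 0) : Q.star hc x y n = 0 := by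
  refine Finset.sum_eq_zero fun p _ => Finset.sum_eq_zero fun q _ => ?_
  by_cases hpq : p + q = n + 1
  · rcases h p q hpq with h | h <;> simp [h]
  · simp [Q.braceT_of_ne hc hpq]

theorem star_eq_brace {a b c : ℤ} (hc : a + b = c) {x : ∀ n, Q.X n a} {y : ∀ n, Q.X n b}
    {n p q : ℕ} (hpq : p + q = n + 1)
    (h : ∀ p' q', p' + q' = n + 1 → p' ≠ p → x p' = 0 ∨ y q' = 0) :
    Q.star hc x y n = Q.brace hpq hc (x p) (y q) := by
  rw [star, Finset.sum_eq_single p, Finset.sum_eq_single q, Q.braceT_of_eq hc hpq]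
  · intro q' _ hq'
    rw [Q.braceT_of_ne hc (by omega)]
    rfl
  · intro hq
    rw [Finset.mem_range] at hq
    omega
  · intro p' _ hp'
    refine Finset.sum_eq_zero fun q' _ => ?_
    by_cases hpq' : p' + q' = n + 1
    · rcases h p' q' hpq' hp' with h | h <;> simp [h]
    · simp [Q.braceT_of_ne hc hpq']
  · intro hp
    rw [Finset.mem_range] at hp
    omega

theorem star_add_left {a b c : ℤ} (hc : a + b = c) (x x' : ∀ n, Q.X n a) (y : ∀ n, Q.X n b)
    (n : ℕ) : Q.star hc (x + x') y n = Q.star hc x y n + Q.star hc x' y n := by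
  simp only [star, Pi.add_apply, map_add, LinearMap.add_apply, Finset.sum_add_distrib]

theorem star_add_right {a b c : ℤ} (hc : a + b = c) (x : ∀ n, Q.X n a) (y y' : ∀ n, Q.X n b)
    (n : ℕ) : Q.star hc x (y + y') n = Q.star hc x y n + Q.star hc x y' n := by
  simp only [star, Pi.add_apply, map_add, Finset.sum_add_distrib]

theorem star_congr {a b c : ℤ} (hc : a + b = c) {x x' : ∀ n, Q.X n a} {y y' : ∀ n, Q.X n b}
    {n : ℕ} (hx : ∀ p, p < n + 2 → x p = x' p) (hy : ∀ q, q < n + 2 → y q = y' q) :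
    Q.star hc x y n = Q.star hc x' y' n := by
  refine Finset.sum_congr rfl fun p hp => Finset.sum_congr rfl fun q hq => ?_
  rw [hx p (Finset.mem_range.1 hp), hy q (Finset.mem_range.1 hq)]

theorem d_star {a b c a' b' c' : ℤ} (hc : a + b = c) (ha : a + 1 = a') (hb : b + 1 = b')
    (hc' : c + 1 = c') (hl : a' + b = c') (hr : a + b' = c')
    (x : ∀ n, Q.X n a) (y : ∀ n, Q.X n b) (n : ℕ) :
    Q.d hc' (Q.star hc x y n) =
      Q.star hl (fun n => Q.d ha (x n)) y n +
        (-1 : k) ^ a • Q.star hr x (fun n => Q.d hb (y n)) n := by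
  simp only [star, map_sum, Finset.smul_sum, ← Finset.sum_add_distrib]
  exact Finset.sum_congr rfl fun p _ => Finset.sum_congr rfl fun q _ =>
    Q.d_braceT hc ha hb hc' hl hr _ _

theorem parSum_eq_zero {p q r n : ℕ} {a b c e g : ℤ} (he : a + b = e) (hg : e + c = g)
    {x : Q.X p a} {y : Q.X q b} {z : Q.X r c} (h : x = 0 ∨ y = 0 ∨ z = 0 ∨ p + q + r ≠ n + 2) :
    Q.parSum p q r n he hg x y z = 0 := by
  refine Finset.sum_eq_zero fun i _ => Finset.sum_eq_zero fun j _ => ?_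
  rcases h with h | h | h | h
  · simp [h]
  · simp [h]
  · simp [h]
  · rw [dif_neg (by tauto)]

/-- The pre-Lie identity for three operations, with all arities of the intermediate composites
summed. -/
theorem sum_braceT_braceT {p q r n N : ℕ} (hN : n + 3 ≤ N) {a b c e f e' g : ℤ}
    (he : a + b = e) (hg : e + c = g) (hf : b + c = f) (hg' : a + f = g)
    (he' : a + c = e') (hg'' : e' + b = g)
    (x : Q.X p a) (y : Q.X q b) (z : Q.X r c)
    (h0 : (p = 0 → x = 0) ∧ (q = 0 → y = 0) ∧ (r = 0 → z = 0)) :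
    ∑ t ∈ Finset.range N, Q.braceT t r n hg (Q.braceT p q t he x y) z =
      ∑ t ∈ Finset.range N, Q.braceT p t n hg' x (Q.braceT q r t hf y z) +
        Q.parSum p q r n he hg x y z + (-1 : k) ^ (b * c) • Q.parSum p r q n he' hg'' x z y := by
  by_cases h : x = 0 ∨ y = 0 ∨ z = 0 ∨ p + q + r ≠ n + 2
  · rw [parSum_eq_zero he hg h, parSum_eq_zero he' hg'' (by
      rw [Nat.add_right_comm p r q]; tauto), Finset.sum_eq_zero, Finset.sum_eq_zero]
    · simp
    · intro t _
      rcases h with h | h | h | h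
      · simp [h]
      · simp [h]
      · simp [h]
      · by_cases h1 : q + r = t + 1
        · rw [Q.braceT_of_ne (p := p) _ (by omega)]; rfl
        · rw [Q.braceT_of_ne (q := r) _ h1]; simp
    · intro t _
      rcases h with h | h | h | h
      · simp [h]
      · simp [h]
      · simp [h]
      · by_cases h1 : p + q = t + 1
        · rw [Q.braceT_of_ne (q := r) _ (by omega)]; rfl
        · rw [Q.braceT_of_ne (q := q) _ h1]; simp
  · push Not at h
    obtain ⟨hx, hy, hz, hn⟩ := h
    -- For `q = r = 0` there would be no intermediate arity `t` on the right, while parallel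
    -- composites could survive on the left; `h0` excludes this.
    have hp : p ≠ 0 := fun h => hx (h0.1 h)
    have hq : q ≠ 0 := fun h => hy (h0.2.1 h)
    have hr : r ≠ 0 := fun h => hz (h0.2.2 h)
    rw [Finset.sum_eq_single (p + q - 1), Finset.sum_eq_single (q + r - 1),
      Q.braceT_of_eq _ (show p + q - 1 + r = n + 1 by omega),
      Q.braceT_of_eq _ (show p + q = p + q - 1 + 1 by omega),
      Q.braceT_of_eq _ (show p + (q + r - 1) = n + 1 by omega),
      Q.braceT_of_eq _ (show q + r = q + r - 1 + 1 by omega)]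
    · exact Q.brace_brace _ he _ hg _ hf _ hg' he' hg'' x y z
    · intro t _ ht
      rw [Q.braceT_of_ne (q := r) hf (by omega)]
      simp
    · intro ht
      rw [Finset.mem_range] at ht
      omega
    · intro t _ ht
      rw [Q.braceT_of_ne (p := p) he (by omega)]
      simp
    · intro ht
      rw [Finset.mem_range] at ht
      omega

/-- Families of degree `1` associate with themselves. -/
theorem star_star (h : ∀ n, Q.X n 1) (h0 : h 0 = 0) (n : ℕ) :
    Q.star (c := 3) rfl (Q.star (c := 2) rfl h h) h n =
      Q.star (c := 3) rfl h (Q.star (c := 2) rfl h h) n := by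
  -- The bound is `n + 3` because `r = 0` allows `t = n + 1`, and then `p` or `q` can be as large as
  -- `n + 2`.
  have hL : Q.star (c := 3) rfl (Q.star (c := 2) rfl h h) h n =
      ∑ p ∈ Finset.range (n + 3), ∑ q ∈ Finset.range (n + 3), ∑ r ∈ Finset.range (n + 3),
        ∑ t ∈ Finset.range (n + 3),
          Q.braceT t r n (c := 3) rfl (Q.braceT p q t (c := 2) rfl (h p) (h q)) (h r) := by
    rw [star_eq_sum_range _ _ _ (show n + 2 ≤ n + 3 by omega)]
    have : ∀ t ∈ Finset.range (n + 2), ∀ r ∈ Finset.range (n + 3),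
        Q.braceT t r n (c := 3) rfl (Q.star (c := 2) rfl h h t) (h r) =
        ∑ p ∈ Finset.range (n + 3), ∑ q ∈ Finset.range (n + 3),
          Q.braceT t r n (c := 3) rfl (Q.braceT p q t (c := 2) rfl (h p) (h q)) (h r) := by
      intro t ht r _
      rw [Finset.mem_range] at ht
      rw [star_eq_sum_range _ _ _ (show t + 2 ≤ n + 3 by omega)]
      simp only [map_sum, LinearMap.sum_apply]
    rw [Finset.sum_range_succ, Finset.sum_eq_zero (s := Finset.range (n + 3))
      (f := fun q => Q.braceT (n + 2) q n _ _ _), add_zero,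
      Finset.sum_congr rfl fun t ht => Finset.sum_congr rfl fun r hr => this t ht r hr]
    · have h2 : ∀ p q r, ∑ t ∈ Finset.range (n + 3),
          Q.braceT t r n (c := 3) rfl (Q.braceT p q t (c := 2) rfl (h p) (h q)) (h r) =
          ∑ t ∈ Finset.range (n + 2),
          Q.braceT t r n (c := 3) rfl (Q.braceT p q t (c := 2) rfl (h p) (h q)) (h r) := by
        intro p q r
        rw [Finset.sum_range_succ, Q.braceT_of_ne (p := n + 2) _ (by omega)]
        simp
      simp only [h2]
      simp only [Finset.sum_comm (s := Finset.range (n + 2))]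
      rw [Finset.sum_comm]
      refine Finset.sum_congr rfl fun p _ => ?_
      rw [Finset.sum_comm]
    · intro r _
      rw [Q.braceT_of_ne _ (by omega)]
      rfl
  have hR : Q.star (c := 3) rfl h (Q.star (c := 2) rfl h h) n =
      ∑ p ∈ Finset.range (n + 3), ∑ q ∈ Finset.range (n + 3), ∑ r ∈ Finset.range (n + 3),
        ∑ t ∈ Finset.range (n + 3),
          Q.braceT p t n (c := 3) rfl (h p) (Q.braceT q r t (c := 2) rfl (h q) (h r)) := by
    rw [star_eq_sum_range _ _ _ (show n + 2 ≤ n + 3 by omega)]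
    refine Finset.sum_congr rfl fun p _ => ?_
    have : ∀ t ∈ Finset.range (n + 2),
        Q.braceT p t n (c := 3) rfl (h p) (Q.star (c := 2) rfl h h t) =
        ∑ q ∈ Finset.range (n + 3), ∑ r ∈ Finset.range (n + 3),
          Q.braceT p t n (c := 3) rfl (h p) (Q.braceT q r t (c := 2) rfl (h q) (h r)) := by
      intro t ht
      rw [Finset.mem_range] at ht
      rw [star_eq_sum_range _ _ _ (show t + 2 ≤ n + 3 by omega)]
      simp only [map_sum]
    have h2 : ∀ q r, ∑ t ∈ Finset.range (n + 3),
        Q.braceT p t n (c := 3) rfl (h p) (Q.braceT q r t (c := 2) rfl (h q) (h r)) =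
        ∑ t ∈ Finset.range (n + 2),
        Q.braceT p t n (c := 3) rfl (h p) (Q.braceT q r t (c := 2) rfl (h q) (h r)) := by
      intro q r
      rw [Finset.sum_range_succ, Q.braceT_of_ne (q := n + 2) _ (by omega)]
      simp
    simp only [h2]
    rw [Finset.sum_range_succ, Q.braceT_of_ne (q := n + 2) _ (by omega), LinearMap.zero_apply,
      LinearMap.zero_apply, add_zero, Finset.sum_congr rfl this, Finset.sum_comm]
    exact Finset.sum_congr rfl fun q _ => Finset.sum_comm
  have hz : ∀ p, p = 0 → h p = 0 := by rintro _ rfl; exact h0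
  rw [hL, hR]
  simp only [fun p q r => sum_braceT_braceT (Q := Q) (p := p) (q := q) (r := r) (n := n) le_rfl
    (e := 2) (f := 2) (e' := 2) (g := 3) rfl rfl rfl rfl rfl rfl (h p) (h q) (h r)
    ⟨hz p, hz q, hz r⟩, Finset.sum_add_distrib]
  -- Only the parallel sums remain. In degree 1 the Koszul sign is `-1`, so exchanging the indices
  -- `q` and `r` cancels them.
  rw [add_assoc, add_eq_left, ← Finset.sum_add_distrib]
  refine Finset.sum_eq_zero fun p _ => ?_
  rw [Finset.sum_comm, ← Finset.sum_add_distrib]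
  refine Finset.sum_eq_zero fun q _ => ?_
  rw [← Finset.sum_add_distrib]
  refine Finset.sum_eq_zero fun r _ => ?_
  simp

/-- The curvature `dh + h{h}` of a family of degree `1`. -/
def curv (h : ∀ n, Q.X n 1) (n : ℕ) : Q.X n 2 :=
  Q.d (b := 2) rfl (h n) + Q.star (c := 2) rfl h h n

/-- The Bianchi identity. -/
theorem d_curv (h : ∀ n, Q.X n 1) (h0 : h 0 = 0) (n : ℕ) :
    Q.d (b := 3) rfl (curv h n) =
      Q.star (c := 3) rfl (curv h) h n - Q.star (c := 3) rfl h (curv h) n := by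
  have h1 : curv h = (fun n => Q.d (b := 2) rfl (h n)) + Q.star (c := 2) rfl h h := rfl
  rw [curv, map_add, Q.d_d, zero_add, 
    d_star (a := 1) (b := 1) (c := 2) (a' := 2) (b' := 2) (c' := 3) rfl rfl rfl rfl rfl rfl, h1,
    star_add_left, star_add_right, star_star h h0, zpow_one, neg_smul, one_smul]
  abel

theorem curv_congr {h h' : ∀ n, Q.X n 1} {n : ℕ} (hh : ∀ p, p < n + 2 → h p = h' p) :
    curv h n = curv h' n := by
  rw [curv, curv, hh n (by omega), star_congr _ hh hh]

end Families

/-! ### The path operad: cochains on subdivided intervals. -/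

namespace Path

/-- The vertex of the outer operation in the composite along the input `l` with an operation of
arity `m`, at the vertex `r` of the composite. -/
def outer (l m r : ℕ) : ℕ := if r < l then r else if r < l + m then l else r + 1 - m

/-- The vertex of the inner operation in the composite along the input `l` with an operation of
arity `m`, at the vertex `r` of the composite. -/
def inner (l m r : ℕ) : ℕ := if r < l then 0 else if r < l + m then r + 1 - l else m + 1

/-- Pairs of a `0`-cochain and a normalised primitive of a `1`-cochain on the path with the
vertices `0, …, n + 1`, with values in the operations of arity `n`.  Functions on the vertices
are extended to `ℕ` so that they are constant from `n + 1` on. -/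
def X (O : DGOperad.{u, v} k) (n : ℕ) (a : ℤ) :
    -- Indexing the primitive by all `b` with `b + 1 = a` avoids transport along equalities of
    -- degrees. The factor `PUnit` only raises the universe to the one that `Hom.Homotopic` asks
    -- for.
    Submodule k ((ℕ → O.X n a) × (∀ b : {b : ℤ // b + 1 = a}, ℕ → O.X n b) × PUnit.{u + 1}) where
  carrier := {x | (∀ r, n + 1 ≤ r → x.1 r = x.1 (n + 1)) ∧ ∀ b,
    x.2.1 b 0 = 0 ∧ ∀ r, n + 1 ≤ r → x.2.1 b r = x.2.1 b (n + 1)}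
  add_mem' := by
    rintro x y ⟨hx, hx'⟩ ⟨hy, hy'⟩
    refine ⟨fun r hr => ?_, fun b => ⟨?_, fun r hr => ?_⟩⟩
    · simp [hx r hr, hy r hr]
    · simp [(hx' b).1, (hy' b).1]
    · simp [(hx' b).2 r hr, (hy' b).2 r hr]
  zero_mem' := ⟨fun _ _ => rfl, fun _ => ⟨rfl, fun _ _ => rfl⟩⟩
  smul_mem' := by
    rintro c x ⟨hx, hx'⟩
    refine ⟨fun r hr => ?_, fun b => ⟨?_, fun r hr => ?_⟩⟩
    · simp [hx r hr]
    · simp [(hx' b).1]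
    · simp [(hx' b).2 r hr]

section

variable {O : DGOperad.{u, v} k} {n : ℕ} {a : ℤ}

/-- The value of the `0`-cochain at a vertex. -/
def w (r : ℕ) : X O n a →ₗ[k] O.X n a where
  toFun x := x.1.1 r
  map_add' _ _ := rfl
  map_smul' _ _ := rfl

/-- The value of the primitive at a vertex. -/
def U (b : ℤ) (h : b + 1 = a) (r : ℕ) : X O n a →ₗ[k] O.X n b where
  toFun x := x.1.2.1 ⟨b, h⟩ r
  map_add' _ _ := rfl
  map_smul' _ _ := rfl

theorem w_of_le (x : X O n a) {r : ℕ} (hr : n + 1 ≤ r) : w r x = w (n + 1) x := x.2.1 r hr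

theorem U_of_le (x : X O n a) (b : ℤ) (h : b + 1 = a) {r : ℕ} (hr : n + 1 ≤ r) :
    U b h r x = U b h (n + 1) x := (x.2.2 ⟨b, h⟩).2 r hr

theorem U_zero (x : X O n a) (b : ℤ) (h : b + 1 = a) : U b h 0 x = 0 := (x.2.2 ⟨b, h⟩).1

theorem ext {x y : X O n a} (hw : ∀ r, w r x = w r y) (hU : ∀ b h r, U b h r x = U b h r y) :
    x = y :=
  Subtype.ext (Prod.ext (funext hw)
    (Prod.ext (funext fun b => funext fun r => hU b b.2 r) rfl))

/-- The element with given cochains. -/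
def mk (f : ℕ → O.X n a) (F : ∀ b : ℤ, b + 1 = a → ℕ → O.X n b)
    (hf : ∀ r, n + 1 ≤ r → f r = f (n + 1))
    (hF : ∀ b h, F b h 0 = 0 ∧ ∀ r, n + 1 ≤ r → F b h r = F b h (n + 1)) : X O n a :=
  ⟨(f, fun b => F b b.2, ⟨⟩), hf, fun b => hF b b.2⟩

@[simp]
theorem w_mk (f : ℕ → O.X n a) (F : ∀ b : ℤ, b + 1 = a → ℕ → O.X n b)
    (hf : ∀ r, n + 1 ≤ r → f r = f (n + 1))
    (hF : ∀ b h, F b h 0 = 0 ∧ ∀ r, n + 1 ≤ r → F b h r = F b h (n + 1)) (r : ℕ) :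
    w r (mk f F hf hF) = f r := rfl

@[simp]
theorem U_mk (f : ℕ → O.X n a) (F : ∀ b : ℤ, b + 1 = a → ℕ → O.X n b)
    (hf : ∀ r, n + 1 ≤ r → f r = f (n + 1))
    (hF : ∀ b h, F b h 0 = 0 ∧ ∀ r, n + 1 ≤ r → F b h r = F b h (n + 1)) (b : ℤ) (h : b + 1 = a)
    (r : ℕ) : U b h r (mk f F hf hF) = F b h r := rfl

end

variable {O : DGOperad.{u, v} k}

/-- The differential: the primitive `w 0 - w r`. -/
def d {n : ℕ} {a b : ℤ} (h : a + 1 = b) : X O n a →ₗ[k] X O n b where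
  toFun x := mk 0 (fun b' h' r => (show a = b' by omega) ▸ (w 0 x - w r x)) (fun _ _ => rfl) (by
    rintro b' h'
    obtain rfl : b' = a := by omega
    exact ⟨sub_self _, fun r hr => by simp [w_of_le x hr]⟩)
  map_add' x y := by
    refine ext (fun r => (add_zero _).symm) fun b' h' r => ?_
    obtain rfl : b' = a := by omega
    simp only [map_add, U_mk]
    abel
  map_smul' c x := by
    refine ext (fun r => by simp) fun b' h' r => ?_
    obtain rfl : b' = a := by omega
    simp [smul_sub]

@[simp]
theorem w_d {n : ℕ} {a b : ℤ} (h : a + 1 = b) (x : X O n a) (r : ℕ) : w r (d h x) = 0 := rfl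

@[simp]
theorem U_d {n : ℕ} {a b : ℤ} (h : a + 1 = b) (x : X O n a) (r : ℕ) (h' : a + 1 = b) :
    U a h' r (d h x) = w 0 x - w r x := rfl

theorem inner_zero {l m : ℕ} (hl : 1 ≤ l) : inner l m 0 = 0 := if_pos hl

theorem outer_zero {l m : ℕ} (hl : 1 ≤ l) : outer l m 0 = 0 := if_pos hl

theorem inner_of_le {p q n l r : ℕ} (hl : 1 ≤ l ∧ l ≤ p) (hn : p + q = n + 1) (hr : n + 1 ≤ r) :
    inner l q r = q + 1 := by
  unfold inner; split_ifs <;> omega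

theorem outer_of_le {p q n l r : ℕ} (hl : 1 ≤ l ∧ l ≤ p) (hn : p + q = n + 1) (hr : n + 1 ≤ r) :
    p + 1 ≤ outer l q r := by
  unfold outer; split_ifs <;> omega

theorem outer_last {p q n l : ℕ} (hl : 1 ≤ l ∧ l ≤ p) (hn : p + q = n + 1) :
    outer l q (n + 1) = p + 1 := by
  unfold outer; split_ifs <;> omega

/-- The infinitesimal compositions. -/
def comp {p q n : ℕ} {a b c : ℤ} (l : ℕ) (hl : 1 ≤ l ∧ l ≤ p) (hn : p + q = n + 1)
    (hc : a + b = c) : X O p a →ₗ[k] X O q b →ₗ[k] X O n c :=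
  LinearMap.mk₂ k
    (fun x y => mk (fun r => O.comp l hl hn hc (w (outer l q r) x) (w (inner l q r) y))
      -- The points `(outer, inner)` lie in order along the lattice path from `(0, 0)` to `(p + 1, q
      -- + 1)` with corners `(l, 0)` and `(l, q + 1)`, possibly skipping the corners. The three
      -- terms integrate over the parts of its three legs traversed up to `r`: first leg, last leg,
      -- middle leg. The sign moves `x` past the edge of `y`.
      (fun c' hc' r =>
        O.comp l hl hn (by omega) (U (a - 1) (by omega) (min r l) x) (w 0 y) +
        O.comp l hl hn (by omega) (U (a - 1) (by omega) (outer l q r) x -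
          U (a - 1) (by omega) (min r l) x) (w (q + 1) y) +
        (-1 : k) ^ a • O.comp l hl hn (by omega) (w l x)
          (U (b - 1) (by omega) (inner l q r) y))
      (fun r hr => by
        rw [inner_of_le hl hn hr, inner_of_le hl hn le_rfl, w_of_le x (outer_of_le hl hn hr),
          outer_last hl hn])
      (fun c' hc' => ⟨by simp [inner_zero hl.1, outer_zero hl.1, U_zero], fun r hr => by
        rw [inner_of_le hl hn hr, inner_of_le hl hn le_rfl, U_of_le x _ _ (outer_of_le hl hn hr),
          outer_last hl hn, min_eq_right (by omega), min_eq_right (by omega)]⟩))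
    (fun x x' y => ext (fun r => by simp) fun _ _ _ => by
      simp only [U_mk, map_add, map_sub, LinearMap.add_apply, LinearMap.sub_apply, smul_add]; abel)
    (fun c x y => ext (fun r => by simp) fun _ _ _ => by
      simp only [U_mk, map_smul, map_sub, LinearMap.smul_apply, LinearMap.sub_apply, smul_add,
        smul_sub, smul_comm c])
    (fun x y y' => ext (fun r => by simp) fun _ _ _ => by
      simp only [U_mk, map_add, smul_add]; abel)
    (fun c x y => ext (fun r => by simp) fun _ _ _ => by
      simp only [U_mk, map_smul, smul_add, smul_comm c])

@[simp]
theorem w_comp {p q n : ℕ} {a b c : ℤ} (l : ℕ) (hl : 1 ≤ l ∧ l ≤ p) (hn : p + q = n + 1)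
    (hc : a + b = c) (x : X O p a) (y : X O q b) (r : ℕ) :
    w r (comp l hl hn hc x y) = O.comp l hl hn hc (w (outer l q r) x) (w (inner l q r) y) := rfl

theorem U_comp {p q n : ℕ} {a b c a' b' c' : ℤ} (l : ℕ) (hl : 1 ≤ l ∧ l ≤ p)
    (hn : p + q = n + 1) (hc : a + b = c) (ha' : a' + 1 = a) (hb' : b' + 1 = b) (hc' : c' + 1 = c)
    (h₁ : a' + b = c') (h₂ : a + b' = c') (x : X O p a) (y : X O q b) (r : ℕ) :
    U c' hc' r (comp l hl hn hc x y) =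
      O.comp l hl hn h₁ (U a' ha' (min r l) x) (w 0 y) +
      O.comp l hl hn h₁ (U a' ha' (outer l q r) x - U a' ha' (min r l) x) (w (q + 1) y) +
      (-1 : k) ^ a • O.comp l hl hn h₂ (w l x) (U b' hb' (inner l q r) y) := by
  obtain rfl : a' = a - 1 := by omega
  obtain rfl : b' = b - 1 := by omega
  rfl

/-- The constant paths. -/
def const {n : ℕ} {a : ℤ} : O.X n a →ₗ[k] X O n a where
  toFun x := mk (fun _ => x) (fun _ _ _ => 0) (fun _ _ => rfl) (fun _ _ => ⟨rfl, fun _ _ => rfl⟩)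
  map_add' _ _ := ext (fun _ => rfl) fun _ _ _ => (add_zero _).symm
  map_smul' _ _ := ext (fun _ => rfl) fun _ _ _ => by simp

@[simp]
theorem w_const {n : ℕ} {a : ℤ} (x : O.X n a) (r : ℕ) : w r (const x) = x := rfl

@[simp]
theorem U_const {n : ℕ} {a : ℤ} (x : O.X n a) (b : ℤ) (h : b + 1 = a) (r : ℕ) :
    U b h r (const x) = 0 := rfl

theorem one_comp {q : ℕ} {b : ℤ} (i : ℕ) (hi : 1 ≤ i ∧ i ≤ 1) (hn : 1 + q = q + 1)
    (hc : 0 + b = b) (y : X O q b) : comp i hi hn hc (const O.one) y = y := by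
  obtain rfl : i = 1 := by omega
  have hw : ∀ r, r ≤ q + 1 → inner 1 q r = r := fun r hr => by
    unfold inner; split_ifs <;> omega
  have hw' : ∀ r, q + 1 ≤ r → inner 1 q r = q + 1 := fun r hr => by
    unfold inner; split_ifs <;> omega
  refine ext (fun r => ?_) fun b' h' r => ?_
  · rw [w_comp, w_const, O.one_comp]
    rcases le_total r (q + 1) with h | h
    · rw [hw r h]
    · rw [hw' r h, w_of_le y h]
  · rw [U_comp (a' := -1) (b' := b') 1 hi hn hc rfl h' h' (by omega) (by omega)]
    simp only [U_const, w_const, map_zero, sub_self, LinearMap.zero_apply, zero_add, zpow_zero,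
      one_smul]
    rw [O.one_comp]
    rcases le_total r (q + 1) with h | h
    · rw [hw r h]
    · rw [hw' r h, U_of_le y _ _ h]

theorem comp_one {p : ℕ} {a : ℤ} (i : ℕ) (hi : 1 ≤ i ∧ i ≤ p) (hn : p + 1 = p + 1)
    (hc : a + 0 = a) (x : X O p a) : comp i hi hn hc x (const O.one) = x := by
  have h : ∀ r, outer i 1 r = r := fun r => by
    unfold outer; split_ifs <;> omega
  refine ext (fun r => ?_) fun b' h' r => ?_
  · rw [w_comp, w_const, h]
    exact O.comp_one _ _ _ _ _
  · rw [U_comp (a' := b') (b' := -1) i hi hn hc h' rfl h' (by omega) (by omega), h]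
    simp only [U_const, w_const, map_zero, smul_zero, add_zero]
    rw [← LinearMap.add_apply, ← map_add, add_sub_cancel]
    exact O.comp_one _ _ _ _ _

/-- Both bracketings traverse the three intervals in the same order. This is the content of the
identities between vertex maps; once they are known, the axiom of `O` applies to each term, with the
edge in `x`, in `y` or in `z`. -/
theorem comp_seq {p q r s t n : ℕ} {a b c e f g : ℤ} (i j l : ℕ)
    (hi : 1 ≤ i ∧ i ≤ p) (hj : 1 ≤ j ∧ j ≤ q) (hl' : l + 1 = i + j) (hl : 1 ≤ l ∧ l ≤ s)
    (hs : p + q = s + 1) (he : a + b = e) (hn : s + r = n + 1) (hg : e + c = g)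
    (ht : q + r = t + 1) (hf : b + c = f) (hn' : p + t = n + 1) (hg' : a + f = g)
    (x : X O p a) (y : X O q b) (z : X O r c) :
    comp l hl hn hg (comp i hi hs he x y) z = comp i hi hn' hg' x (comp j hj ht hf y z) := by
  have h1 : ∀ v, outer i q (outer l r v) = outer i t v := fun v => by
    unfold outer; split_ifs <;> omega
  have h2 : ∀ v, inner i q (outer l r v) = outer j r (inner i t v) := fun v => by
    unfold inner outer; split_ifs <;> omega
  have h3 : ∀ v, inner l r v = inner j r (inner i t v) := fun v => by
    unfold inner; split_ifs <;> omega
  have h4 : ∀ v, outer i q (min v l) = min v i := fun v => by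
    unfold outer; split_ifs <;> omega
  have h5 : ∀ v, min (min v l) i = min v i := fun v => by omega
  have h6 : ∀ v, min (outer l r v) i = min v i := fun v => by
    unfold outer; split_ifs <;> omega
  have h7 : ∀ v, inner i q (min v l) = min (inner i t v) j := fun v => by
    unfold inner; split_ifs <;> omega
  have h8 : outer i q l = i := by unfold outer; split_ifs <;> omega
  have h9 : inner i q l = j := by unfold inner; split_ifs <;> omega
  refine ext (fun v => ?_) fun g' hg₁ v => ?_
  · simp only [w_comp]
    rw [O.comp_seq i j l hi hj hl' hl hs he hn hg ht hf hn' hg', h1, h2, h3]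
  · rw [U_comp (a' := e - 1) (b' := c - 1) l hl hn hg (by omega) (by omega) hg₁ (by omega)
      (by omega),
      U_comp (a' := a - 1) (b' := f - 1) i hi hn' hg' (by omega) (by omega) hg₁ (by omega)
      (by omega)]
    simp only [w_comp, U_comp (a' := a - 1) (b' := b - 1) (c' := e - 1) i hi hs he (by omega)
      (by omega) (by omega) (by omega) (by omega), U_comp (a' := b - 1) (b' := c - 1)
      (c' := f - 1) j hj ht hf (by omega) (by omega) (by omega) (by omega) (by omega),
      map_add, map_sub, map_smul, LinearMap.add_apply, LinearMap.sub_apply, LinearMap.smul_apply,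
      smul_add, smul_sub, smul_smul, negOne_zpow_mul, he, h1, h2, h3, h4, h5, h6, h7, h8, h9,
      outer_zero hj.1, inner_zero hj.1, outer_last hj ht, inner_of_le hj ht le_rfl,
      O.comp_seq (a := a - 1) (b := b) (c := c) (e := e - 1) (f := f) (g := g') i j l hi hj hl' hl
        hs (by omega) hn (by omega) ht hf hn' (by omega),
      O.comp_seq (a := a) (b := b - 1) (c := c) (e := e - 1) (f := f - 1) (g := g') i j l hi hj
        hl' hl hs (by omega) hn (by omega) ht (by omega) hn' (by omega),
      O.comp_seq (a := a) (b := b) (c := c - 1) (e := e) (f := f - 1) (g := g') i j l hi hj hl' hl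
        hs he hn (by omega) ht (by omega) hn' (by omega)]
    abel

/-- As `i < j`, the path runs through `y` before it enters `z`, whichever is inserted first: `y` is
at its last vertex when `z` moves (`h9`), and `z` is at its initial vertex when `y` moves (`h14`).
Planar order thus does the work of commutativity. -/
theorem comp_par {p q r s t n : ℕ} {a b c e f g : ℤ} (i j l : ℕ)
    (hi : 1 ≤ i ∧ i ≤ p) (hj : 1 ≤ j ∧ j ≤ p) (hij : i < j) (hl' : l + 1 = j + q)
    (hl : 1 ≤ l ∧ l ≤ s) (hi' : 1 ≤ i ∧ i ≤ t)
    (hs : p + q = s + 1) (he : a + b = e) (hn : s + r = n + 1) (hg : e + c = g)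
    (ht : p + r = t + 1) (hf : a + c = f) (hn' : t + q = n + 1) (hg' : f + b = g)
    (x : X O p a) (y : X O q b) (z : X O r c) :
    comp l hl hn hg (comp i hi hs he x y) z =
      (-1 : k) ^ (b * c) • comp i hi' hn' hg' (comp j hj ht hf x z) y := by
  have h1 : ∀ v, outer i q (outer l r v) = outer j r (outer i q v) := fun v => by
    unfold outer; split_ifs <;> omega
  have h2 : ∀ v, inner i q (outer l r v) = inner i q v := fun v => by
    unfold inner outer; split_ifs <;> omega
  have h3 : ∀ v, inner l r v = inner j r (outer i q v) := fun v => by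
    unfold inner outer; split_ifs <;> omega
  have h4 : ∀ v, outer i q (min v l) = min (outer i q v) j := fun v => by
    unfold outer; split_ifs <;> omega
  have h5 : ∀ v, min (min v l) i = min v i := fun v => by omega
  have h6 : ∀ v, min (outer l r v) i = min v i := fun v => by
    unfold outer; split_ifs <;> omega
  have h7 : ∀ v, inner i q (min v l) = inner i q v := fun v => by
    unfold inner; split_ifs <;> omega
  have h8 : outer i q l = j := by unfold outer; split_ifs <;> omega
  have h9 : inner i q l = q + 1 := by unfold inner; split_ifs <;> omega
  have h10 : ∀ v, min (min v i) j = min v i := fun v => by omega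
  have h11 : ∀ v, outer j r (min v i) = min v i := fun v => by
    unfold outer; split_ifs <;> omega
  have h12 : ∀ v, inner j r (min v i) = 0 := fun v => by
    unfold inner; split_ifs <;> omega
  have h13 : outer j r i = i := by unfold outer; split_ifs <;> omega
  have h14 : inner j r i = 0 := by unfold inner; split_ifs <;> omega
  refine ext (fun v => ?_) fun g' hg₁ v => ?_
  · rw [map_smul]
    simp only [w_comp]
    rw [O.comp_par i j l hi hj hij hl' hl hi' hs he hn hg ht hf hn' hg', h1, h2, h3]
  · rw [map_smul, U_comp (a' := e - 1) (b' := c - 1) l hl hn hg (by omega) (by omega) hg₁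
      (by omega) (by omega),
      U_comp (a' := f - 1) (b' := b - 1) i hi' hn' hg' (by omega) (by omega) hg₁ (by omega)
      (by omega)]
    -- Signs of the terms with the edge in `z` (`s1`) and in `y` (`s2`), where the Koszul sign of
    -- `O` sees a degree lowered by one.
    have s1 : (-1 : k) ^ (b * (c - 1) + e) = (-1 : k) ^ (b * c + a) :=
      negOne_zpow_congr ⟨0, by subst he; ring⟩
    have s2 : (-1 : k) ^ ((b - 1) * c + a) = (-1 : k) ^ (b * c + f) :=
      negOne_zpow_congr ⟨-c, by subst hf; ring⟩
    simp only [w_comp, U_comp (a' := a - 1) (b' := b - 1) (c' := e - 1) i hi hs he (by omega)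
      (by omega) (by omega) (by omega) (by omega), U_comp (a' := a - 1) (b' := c - 1)
      (c' := f - 1) j hj ht hf (by omega) (by omega) (by omega) (by omega) (by omega),
      map_add, map_sub, map_smul, LinearMap.add_apply, LinearMap.sub_apply, LinearMap.smul_apply,
      h1, h2, h3, h4, h5, h6, h7, h8, h9, h10, h11, h12, h13, h14, U_zero, map_zero,
      O.comp_par (a := a - 1) (b := b) (c := c) (e := e - 1) (f := f - 1) (g := g') i j l hi hj
        hij hl' hl hi' hs (by omega) hn (by omega) ht (by omega) hn' (by omega),
      O.comp_par (a := a) (b := b - 1) (c := c) (e := e - 1) (f := f) (g := g') i j l hi hj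
        hij hl' hl hi' hs (by omega) hn (by omega) ht hf hn' (by omega),
      O.comp_par (a := a) (b := b) (c := c - 1) (e := e) (f := f - 1) (g := g') i j l hi hj hij
        hl' hl hi' hs he hn (by omega) ht (by omega) hn' (by omega),
      smul_add, smul_sub, smul_smul, negOne_zpow_mul, smul_comm ((-1 : k) ^ a),
      add_comm e, s1, s2, LinearMap.zero_apply, smul_zero]
    abel

/-- A telescoping sum: the composite at vertex 0 minus the composite at `v` is the sum of the
differences along the legs of the path up to `v`. The three cases are the leg that `v` has reached.
-/
theorem d_comp {p q n : ℕ} {a b c a' b' c' : ℤ} (i : ℕ) (hi : 1 ≤ i ∧ i ≤ p)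
    (hn : p + q = n + 1) (hc : a + b = c) (ha : a + 1 = a') (hb : b + 1 = b')
    (hc' : c + 1 = c') (hl : a' + b = c') (hr : a + b' = c') (x : X O p a) (y : X O q b) :
    d hc' (comp i hi hn hc x y) =
      comp i hi hn hl (d ha x) y + (-1 : k) ^ a • comp i hi hn hr x (d hb y) := by
  refine ext (fun v => by simp) fun c₁ hc₁ v => ?_
  obtain rfl : c₁ = c := by omega
  rw [map_add, map_smul, U_comp (a' := a) (b' := b - 1) i hi hn hl ha (by omega) hc'
    hc (by omega), U_comp (a' := a - 1) (b' := b) i hi hn hr (by omega) hb hc' (by omega) hc]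
  simp only [w_comp, w_d, U_d, map_zero, LinearMap.zero_apply, zero_add, smul_zero, add_zero,
    smul_smul, negOne_zpow_mul, Even.neg_one_zpow ⟨a, rfl⟩, one_smul, map_sub,
    LinearMap.sub_apply, outer_zero hi.1, inner_zero hi.1]
  unfold outer inner
  split_ifs with h1 h2
  · rw [min_eq_left h1.le]; abel
  · rw [min_eq_right (not_lt.1 h1)]; abel
  · rw [min_eq_right (not_lt.1 h1)]; abel

theorem d_eq_zero {n : ℕ} {a b : ℤ} (h : a + 1 = b) {x : X O n a} (hx : ∀ r, w r x = w 0 x) :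
    d h x = 0 := by
  refine ext (fun r => rfl) fun b' h' r => ?_
  obtain rfl : b' = a := by omega
  rw [U_d, map_zero, hx r, sub_self]

theorem w_eq_of_d_eq_zero {n : ℕ} {a b : ℤ} (h : a + 1 = b) {x : X O n a} (hx : d h x = 0)
    (r : ℕ) : w r x = w 0 x := by
  have := U_d h x r h
  rw [hx, map_zero] at this
  exact (sub_eq_zero.1 this.symm).symm

end Path

/-! ### The path object of a graded operad. -/

/-- The path operad of a graded operad. -/
def path (O : DGOperad.{u, v} k) : DGOperad.{u, max u v} k where
  X n a := Path.X O n a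
  d := Path.d
  d_d _ h' _ := Path.d_eq_zero h' fun _ => rfl
  one := Path.const O.one
  d_one h := Path.d_eq_zero h fun _ => rfl
  comp := Path.comp
  one_comp := Path.one_comp
  comp_one := Path.comp_one
  comp_seq := Path.comp_seq
  comp_par := Path.comp_par
  d_comp := Path.d_comp

namespace Path

variable {O : DGOperad.{u, v} k}

/-- The inclusion of constant paths. -/
def constHom (hO : O.IsGraded) : Hom O (path O) where
  app _ _ := const
  app_d h x := by
    rw [hO]
    exact (map_zero (const (O := O))).trans (d_eq_zero h fun _ => rfl).symm
  app_one := rfl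
  app_comp {p q n a b c} i hi hn hc x y := by
    refine ext (fun _ => rfl) fun c' hc' r => Eq.symm ?_
    refine (U_comp (a' := a - 1) (b' := b - 1) i hi hn hc (by omega) (by omega) hc' (by omega)
      (by omega) (const x) (const y) r).trans ?_
    simp only [U_const, map_zero, LinearMap.zero_apply, sub_self, smul_zero, add_zero]
    exact (U_const _ c' hc' r).symm

/-- The initial vertex. -/
def source (hO : O.IsGraded) : Hom (path O) O where
  app _ _ := w 0
  app_d h x := (hO h _).symm
  app_one := rfl
  app_comp i hi hn hc x y := by
    change O.comp i hi hn hc (w (outer i _ 0) x) (w (inner i _ 0) y) = _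
    rw [outer_zero hi.1, inner_zero hi.1]
    rfl

/-- The final vertex. -/
def target (hO : O.IsGraded) : Hom (path O) O where
  app n _ := w (n + 1)
  app_d h x := (hO h _).symm
  app_one := rfl
  app_comp {p q n a b c} i hi hn hc x y := by
    change O.comp i hi hn hc (w (outer i _ (n + 1)) x) (w (inner i _ (n + 1)) y) = _
    rw [outer_last hi hn, inner_of_le hi hn le_rfl]
    rfl

/-- Coboundaries vanish at all vertices, which gives injectivity. A cocycle is constant on vertices,
and the rest of it is a 1-cochain, which is bounded by its own primitive. -/
theorem constHom_isQuasiIso (hO : O.IsGraded) : (constHom hO).IsQuasiIso := by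
  intro n a
  constructor
  · rw [injective_iff_map_eq_zero]
    rintro ⟨x, hx⟩ h
    obtain ⟨y, hy⟩ := (Submodule.Quotient.mk_eq_zero _).1 h
    refine (Submodule.Quotient.mk_eq_zero _).2 ⟨0, ?_⟩
    have h0 : x = 0 := (congrArg (w (O := O) 0) hy).symm
    rw [map_zero]
    exact h0.symm
  · rintro ⟨z, hz⟩
    refine ⟨Submodule.Quotient.mk ⟨w 0 z, hO _ _⟩, (Submodule.Quotient.eq _).2
      -- The primitive of `z`, read as a 0-cochain. Its differential has primitive `U 0 - U r = -U
      -- r`, as needed for the constant path minus `z`.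
      ⟨mk (fun r => U (a - 1) (by omega) r z) (fun _ _ _ => 0)
        (fun r hr => U_of_le z _ _ hr) (fun _ _ => ⟨rfl, fun _ _ => rfl⟩),
        ext (fun r => ?_) fun b h r => ?_⟩⟩
    · have h1 : w r z = w 0 z := w_eq_of_d_eq_zero rfl hz r
      change 0 = w 0 z - w r z
      rw [h1, sub_self]
    · obtain rfl : b = a - 1 := by omega
      change U (a - 1) h 0 z - U (a - 1) h r z = 0 - U (a - 1) h r z
      exact congrArg (· - U (a - 1) h r z) (U_zero z _ h)

end Path

/-- The path object of a graded operad. -/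
def pathObject {O : DGOperad.{u, v} k} (hO : O.IsGraded) : PathObject.{u, v, max u v} O where
  P := path O
  s := Path.constHom hO
  p₀ := Path.source hO
  p₁ := Path.target hO
  p₀_s := rfl
  p₁_s := rfl
  weakEquiv := Path.constHom_isQuasiIso hO
  fibration n a x y := ⟨Path.mk (fun r => if r = 0 then x else y) (fun _ _ _ => 0)
    (fun r hr => by rw [if_neg (by omega), if_neg (by omega)])
    (fun _ _ => ⟨rfl, fun _ _ => rfl⟩), 
      (if_pos rfl : (if 0 = 0 then x else y) = x),
      (if_neg (Nat.succ_ne_zero n) : (if n + 1 = 0 then x else y) = y)⟩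

/-! ### Morphisms from the `A∞`-operad as families of curvature zero. -/

theorem Hom.app_brace {P : DGOperad.{u, v} k} {Q : DGOperad.{u, w} k} (φ : Hom P Q)
    {p q n : ℕ} {a b c : ℤ} (hn : p + q = n + 1) (hc : a + b = c) (x : P.X p a) (y : P.X q b) :
    φ.app n c (P.brace hn hc x y) = Q.brace hn hc (φ.app p a x) (φ.app q b y) := by
  simp only [brace_apply, map_sum, φ.app_comp]

theorem Hom.app_star {P : DGOperad.{u, v} k} {Q : DGOperad.{u, w} k} (φ : Hom P Q)
    {a b c : ℤ} (hc : a + b = c) (x : ∀ n, P.X n a) (y : ∀ n, P.X n b) (n : ℕ) :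
    φ.app n c (P.star hc x y n) =
      Q.star hc (fun n => φ.app n a (x n)) (fun n => φ.app n b (y n)) n := by
  simp only [star, map_sum]
  refine Finset.sum_congr rfl fun p _ => Finset.sum_congr rfl fun q _ => ?_
  by_cases hn : p + q = n + 1
  · rw [braceT_of_eq _ _ hn, braceT_of_eq _ _ hn, φ.app_brace]
  · rw [braceT_of_ne _ _ hn, braceT_of_ne _ _ hn]
    simp

theorem Hom.app_curv {P : DGOperad.{u, v} k} {Q : DGOperad.{u, w} k} (φ : Hom P Q)
    (h : ∀ n, P.X n 1) (n : ℕ) :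
    φ.app n 2 (curv h n) = curv (fun n => φ.app n 1 (h n)) n := by
  rw [curv, map_add, φ.app_d, φ.app_star, curv]

/-- The suspension of a morphism. -/
def Hom.susp {P : DGOperad.{u, v} k} {Q : DGOperad.{u, w} k} (φ : Hom P Q) :
    Hom P.susp Q.susp where
  app n a := φ.app n (a + 1 - n)
  app_d {n a b} h x := by
    exact (map_smul (φ.app n _) ((-1 : k) ^ (1 - (n : ℤ))) _).trans
      (congrArg (fun y => (-1 : k) ^ (1 - (n : ℤ)) • y) (φ.app_d _ _))
  app_one := φ.app_one
  app_comp {p q n a b c} i hi hn hc x y := by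
    exact (map_smul (φ.app n _) ((-1 : k) ^ (((q : ℤ) - 1) * (a + 1 - i))) _).trans
      (congrArg (fun y => (-1 : k) ^ (((q : ℤ) - 1) * (a + 1 - i)) • y)
        (φ.app_comp i hi hn _ _ _))

/-- The extension by zero of a family of operations of arities at least `2`. -/
def extend {P : DGOperad.{u, v} k} (m : ∀ n : ℕ, 2 ≤ n → P.X n 1) (n : ℕ) : P.X n 1 :=
  if hn : 2 ≤ n then m n hn else 0

theorem extend_of_le {P : DGOperad.{u, v} k} (m : ∀ n : ℕ, 2 ≤ n → P.X n 1) {n : ℕ}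
    (hn : 2 ≤ n) : extend m n = m n hn := dif_pos hn

theorem extend_of_lt {P : DGOperad.{u, v} k} (m : ∀ n : ℕ, 2 ≤ n → P.X n 1) {n : ℕ}
    (hn : n < 2) : extend m n = 0 := dif_neg (by omega)

theorem star_extend {Q : DGOperad.{u, v} k} (m : ∀ n : ℕ, 2 ≤ n → Q.X n 1) (n : ℕ)
    (hn : 2 ≤ n) :
    Q.star (c := 2) rfl (extend m) (extend m) n = ∑ s : Fin (n - 2),
      Q.brace (n := n) (c := 2) (by omega) rfl
        (m (s.val + 2) (by omega)) (m (n - 1 - s.val) (by omega)) := by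
  rw [star, sum_range_three _ 2 (n - 2) (n + 2) (by omega),
    Finset.sum_eq_zero (s := Finset.range 2), zero_add,
    Finset.sum_eq_zero (s := Finset.range (n + 2 - (2 + (n - 2)))), add_zero,
    ← Fin.sum_univ_eq_sum_range (fun j => ∑ q ∈ Finset.range (n + 2), Q.braceT (2 + j) q n
      (c := 2) rfl (extend m (2 + j)) (extend m q))]
  · refine Finset.sum_congr rfl fun s _ => ?_
    have hs := s.2
    rw [add_comm 2, Finset.sum_eq_single (n - 1 - s.val), braceT_of_eq _ _ (by omega),
      extend_of_le, extend_of_le]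
    · intro q _ hq
      rw [braceT_of_ne _ _ (by omega)]
      rfl
    · intro h
      rw [Finset.mem_range] at h
      omega
  · intro p _
    refine Finset.sum_eq_zero fun q _ => ?_
    by_cases h : q < 2
    · rw [extend_of_lt m h, map_zero]
    · rw [braceT_of_ne _ _ (by omega)]
      rfl
  · intro p hp
    rw [extend_of_lt m (Finset.mem_range.1 hp)]
    simp

/-- Extending by zero adds no condition: in arity at most 1 every product has a factor of arity
below 2. The equations now have Maurer–Cartan form, to which the Bianchi identity applies. -/
theorem isAInf_iff_curv (P : DGOperad.{u, v} k) (m : ∀ n : ℕ, 2 ≤ n → P.susp.X n 1) :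
    IsAInf P m ↔ ∀ n, curv (extend m) n = 0 := by
  have key : ∀ n (hn : 2 ≤ n), curv (extend m) n = P.susp.d (b := 2) rfl (m n hn) +
      ∑ s : Fin (n - 2), P.susp.brace (n := n) (c := 2) (by omega) rfl
        (m (s.val + 2) (by omega)) (m (n - 1 - s.val) (by omega)) := by
    intro n hn
    rw [curv, star_extend m n hn, extend_of_le m hn]
  constructor
  · intro h n
    by_cases hn : 2 ≤ n
    · rw [key n hn]
      exact h n hn
    · rw [curv, extend_of_lt m (by omega), map_zero, zero_add]
      refine star_eq_zero _ fun p q hpq => ?_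
      by_cases hp : p < 2
      · exact Or.inl (extend_of_lt m hp)
      · exact Or.inr (extend_of_lt m (by omega))
  · intro h n hn
    rw [← key n hn, h]

theorem Hom.isAInf_op {O : DGOperad.{u, v} k} (f : Hom (AInf k) O) : IsAInf O f.op := by
  rw [isAInf_iff_curv]
  intro n
  have h : extend (P := O.susp) f.op = fun n => f.susp.app n 1 (extend (AInf.m k) n) := by
    funext n
    by_cases hn : 2 ≤ n
    · rw [extend_of_le _ hn, extend_of_le _ hn]
      rfl
    · rw [extend_of_lt _ (by omega), extend_of_lt _ (by omega), map_zero]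
  rw [h, ← f.susp.app_curv, (isAInf_iff_curv _ _).1 (AInf.isAInf_m k), map_zero]

theorem AInf.app_mk {O : DGOperad.{u, v} k} (f : Hom (AInf k) O) {n : ℕ} {a : ℤ}
    (x : AInf.Pre k n a) : f.app n a (AInf.mk x) = AInf.eval f.op x := by
  induction x with
  | m n hn => rfl
  | one => exact f.app_one
  | zero n a => exact map_zero _
  | add x y hx hy => exact (map_add (f.app _ _) (mk x) (mk y)).trans (congrArg₂ _ hx hy)
  | smul r x hx => exact (map_smul (f.app _ _) r (mk x)).trans (congrArg (r • ·) hx)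
  | d h x hx => exact (f.app_d h (mk x)).trans (congrArg (O.d h) hx)
  | comp i hi hn hc x y hx hy =>
    exact (f.app_comp i hi hn hc (mk x) (mk y)).trans
      (congrArg₂ (fun x y => O.comp i hi hn hc x y) hx hy)

/-- A morphism from the `A∞`-operad is determined by its operations. -/
theorem AInf.hom_ext {O : DGOperad.{u, v} k} {f g : Hom (AInf k) O}
    (h : ∀ n hn, f.op n hn = g.op n hn) : f = g := by
  have h' : f.op = g.op := funext fun n => funext fun hn => h n hn
  refine Hom.ext (funext fun n => funext fun a => LinearMap.ext ?_)
  rintro ⟨x⟩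
  exact (AInf.app_mk f x).trans ((congrArg (fun M => AInf.eval M x) h').trans
    (AInf.app_mk g x).symm)

/-! ### Morphisms from the associative operad -/

section Ass

variable {O : DGOperad.{u, v} k}

theorem comp_seq_zero {p q r s t n : ℕ} (i j l : ℕ)
    (hi : 1 ≤ i ∧ i ≤ p) (hj : 1 ≤ j ∧ j ≤ q) (hl' : l + 1 = i + j) (hl : 1 ≤ l ∧ l ≤ s)
    (hs : p + q = s + 1) (hn : s + r = n + 1) (ht : q + r = t + 1) (hn' : p + t = n + 1)
    (x : O.X p 0) (y : O.X q 0) (z : O.X r 0) :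
    O.comp l hl hn (add_zero 0) (O.comp i hi hs (add_zero 0) x y) z =
      O.comp i hi hn' (add_zero 0) x (O.comp j hj ht (add_zero 0) y z) :=
  O.comp_seq i j l hi hj hl' hl hs _ hn _ ht _ hn' _ x y z

theorem comp_par_zero {p q r s t n : ℕ} (i j l : ℕ)
    (hi : 1 ≤ i ∧ i ≤ p) (hj : 1 ≤ j ∧ j ≤ p) (hij : i < j) (hl' : l + 1 = j + q)
    (hl : 1 ≤ l ∧ l ≤ s) (hi' : 1 ≤ i ∧ i ≤ t)
    (hs : p + q = s + 1) (hn : s + r = n + 1) (ht : p + r = t + 1) (hn' : t + q = n + 1)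
    (x : O.X p 0) (y : O.X q 0) (z : O.X r 0) :
    O.comp l hl hn (add_zero 0) (O.comp i hi hs (add_zero 0) x y) z =
      O.comp i hi' hn' (add_zero 0) (O.comp j hj ht (add_zero 0) x z) y := by
  rw [O.comp_par i j l hi hj hij hl' hl hi' hs _ hn _ ht (add_zero 0) hn' (add_zero 0) x y z,
    mul_zero, zpow_zero, one_smul]

/-- Iterated products, `m ∘₁ (m ∘₁ ⋯)`. -/
def iterProd (m : O.X 2 0) : ∀ n : ℕ, O.X n 0
  | 0 => 0
  | 1 => O.one
  | n + 2 => O.comp 1 (by omega) (by omega) (add_zero 0) m (iterProd m (n + 1))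

theorem iterProd_succ (m : O.X 2 0) {n : ℕ} (hn : 1 ≤ n) : iterProd m (n + 1) =
    O.comp 1 (by omega) (by omega) (add_zero 0) m (iterProd m n) := by
  obtain ⟨n, rfl⟩ := Nat.exists_eq_add_of_le' hn
  rfl

/-- The associativity of a binary operation of degree `0`. -/
def IsAssoc (m : O.X 2 0) : Prop :=
  (O.comp 1 (by omega) (by omega) (add_zero 0) m m : O.X 3 0) =
    O.comp 2 (by omega) (by omega) (add_zero 0) m m

/-- The product of two left-nested products is again left-nested: by induction on `q`, associativity
moves one factor `m` at a time to the outside. -/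
theorem comp_two_iterProd {m : O.X 2 0} (hm : IsAssoc m) {p : ℕ} (hp : 1 ≤ p) {q : ℕ}
    (hq : 1 ≤ q) {s n : ℕ} (hs : 2 + q = s + 1) (hn : s + p = n + 1) (hs1 : 1 ≤ 1 ∧ 1 ≤ s) :
    O.comp 1 hs1 hn (add_zero 0) (O.comp 2 (by omega) hs (add_zero 0) m (iterProd m q))
      (iterProd m p) = iterProd m n := by
  induction q, hq using Nat.le_induction generalizing s n with
  | base =>
    obtain rfl : s = 2 := by omega
    obtain rfl : n = p + 1 := by omega
    change O.comp 1 _ _ _ (O.comp 2 _ _ _ m O.one) _ = _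
    rw [O.comp_one 2 (by omega) rfl (add_zero 0), iterProd_succ m hp]
  | succ q hq ih =>
    obtain rfl : s = q + 2 := by omega
    obtain rfl : n = q + p + 1 := by omega
    rw [iterProd_succ m hq, iterProd_succ m (show 1 ≤ q + p by omega),
      ← comp_seq_zero (s := 3) 2 1 2 (by omega) (by omega) rfl (by omega) (by omega) (by omega)
        (by omega) (by omega) m m (iterProd m q), ← hm,
      comp_seq_zero (t := q + 1) 1 2 2 (by omega) (by omega) rfl (by omega) (by omega) (by omega)
        (by omega) (by omega) m m (iterProd m q),
      comp_seq_zero (t := q + p) 1 1 1 (by omega) (by omega) rfl (by omega) (by omega) (by omega)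
        (by omega) (by omega) m _ (iterProd m p), ih]

/-- Peel off the outermost `m`. An insertion into one of the first inputs is handled by induction;
an insertion into the last input is a product of two iterated products. -/
theorem iterProd_comp {m : O.X 2 0} (hm : IsAssoc m) {q : ℕ} (hq : 1 ≤ q) {p : ℕ} (hp : 1 ≤ p)
    {n : ℕ} (i : ℕ) (hi : 1 ≤ i ∧ i ≤ p) (hn : p + q = n + 1) :
    O.comp i hi hn (add_zero 0) (iterProd m p) (iterProd m q) = iterProd m n := by
  induction p, hp using Nat.le_induction generalizing n i with
  | base =>
    obtain rfl : n = q := by omega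
    exact O.one_comp i hi hn (add_zero 0) _
  | succ p hp ih =>
    obtain rfl : n = p + q := by omega
    rw [iterProd_succ m hp]
    by_cases h : i ≤ p
    · obtain ⟨n, hn'⟩ : ∃ n, p + q = n + 1 := ⟨p + q - 1, by omega⟩
      rw [comp_seq_zero (t := n) 1 i i (by omega) ⟨hi.1, h⟩ (by omega) hi (by omega) hn
        hn' (by omega) m (iterProd m p) (iterProd m q), ih i ⟨hi.1, h⟩ hn']
      have h1 := iterProd_succ m (n := n) (by omega)
      rw! [hn']
      exact h1.symm
    · obtain rfl : i = p + 1 := by omega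
      rw [comp_par_zero (t := q + 1) 1 2 (p + 1) (by omega) (by omega) (by omega) (by omega)
        hi (by omega) (by omega) hn (by omega) (by omega) m (iterProd m p) (iterProd m q)]
      exact comp_two_iterProd hm hp hq _ _ _

/-- The morphism from the associative operad given by an associative operation. -/
def fromAss (hO : O.IsGraded) {m : O.X 2 0} (hm : IsAssoc m) : Hom (Ass k) O where
  app n a :=
    { toFun := fun x => if h : a = 0 then h ▸ (x.1 • iterProd m n) else 0
      map_add' := fun x y => by
        by_cases h : a = 0
        · subst h
          exact add_smul x.1 y.1 _
        · simp only [dif_neg h]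
          exact (add_zero _).symm
      map_smul' := fun r x => by
        by_cases h : a = 0
        · subst h
          exact mul_smul r x.1 _
        · simp only [dif_neg h]
          exact (smul_zero _).symm }
  app_d h x := (map_zero _).trans (hO h _).symm
  app_one := one_smul k O.one
  app_comp {p q n a b c} i hi hn hc x y := by
    by_cases ha : 1 ≤ p ∧ a = 0
    · by_cases hb : 1 ≤ q ∧ b = 0
      · obtain ⟨hp, rfl⟩ := ha
        obtain ⟨hq, rfl⟩ := hb
        obtain rfl : c = 0 := by omega
        change (x.1 * y.1) • iterProd m n = O.comp i hi hn hc (x.1 • iterProd m p)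
          (y.1 • iterProd m q)
        rw [map_smul, map_smul, LinearMap.smul_apply, smul_smul, iterProd_comp hm hq hp, mul_comm]
      · have hy : y = 0 := Subtype.ext
          (show (y.1 : k) = 0 by simpa only [if_neg hb, Submodule.mem_bot] using y.2)
        subst hy
        simp only [map_zero]
    · have hx : x = 0 := Subtype.ext
          (show (x.1 : k) = 0 by simpa only [if_neg ha, Submodule.mem_bot] using x.2)
      subst hx
      simp only [map_zero, LinearMap.zero_apply]

end Ass

/-! ### Values at the final vertex, and the signs of the suspension. -/

namespace Path

variable {O : DGOperad.{u, v} k}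

/-- Only the middle leg survives, and along it `x` stays at vertex `i`. -/
theorem top_comp_right {p q n : ℕ} {a b c b' c' : ℤ} (i : ℕ) (hi : 1 ≤ i ∧ i ≤ p)
    (hn : p + q = n + 1) (hc : a + b = c) (hb' : b' + 1 = b) (hc' : c' + 1 = c)
    (h : a + b' = c') (x : X O p a) (z : X O q b) (hz : ∀ r, w r z = 0) :
    U c' hc' (n + 1) (comp i hi hn hc x z) =
      (-1 : k) ^ a • O.comp i hi hn h (w i x) (U b' hb' (q + 1) z) := by
  rw [U_comp (a' := a - 1) i hi hn hc (by omega) hb' hc' (by omega) h, hz, hz,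
    inner_of_le hi hn le_rfl]
  simp

/-- The middle leg vanishes with the vertices of `z`. On the outer legs `x` takes its first and its
last value; as these agree, the two integrals of `z` add up to the full one. -/
theorem top_comp_left {p q n : ℕ} {a b c a' c' : ℤ} (i : ℕ) (hi : 1 ≤ i ∧ i ≤ p)
    (hn : p + q = n + 1) (hc : a + b = c) (ha' : a' + 1 = a) (hc' : c' + 1 = c)
    (h : a' + b = c') (z : X O p a) (x : X O q b) (hz : ∀ r, w r z = 0)
    (hx : ∀ r, w r x = w 0 x) :
    U c' hc' (n + 1) (comp i hi hn hc z x) = O.comp i hi hn h (U a' ha' (p + 1) z) (w 0 x) := by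
  rw [U_comp (b' := b - 1) i hi hn hc ha' (by omega) hc' h (by omega), hz, hx (q + 1),
    outer_last hi hn, map_sub]
  simp

/-- The element given by a primitive that vanishes at the initial vertex and is constant on the
other vertices. -/
def step {n : ℕ} {a b : ℤ} (h : b + 1 = a) (c : O.X n b) : X O n a :=
  mk 0 (fun b' h' r => if r = 0 then 0 else (show b = b' by omega) ▸ c) (fun _ _ => rfl)
    (fun _ _ => ⟨if_pos rfl, fun r hr => by rw [if_neg (by omega), if_neg (by omega)]⟩)

theorem U_step {n : ℕ} {a b : ℤ} (h h' : b + 1 = a) (c : O.X n b) {r : ℕ} (hr : r ≠ 0) :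
    U b h' r (step h c) = c := if_neg hr

/-- The value of the primitive at the final vertex, for elements of the suspension. -/
def top {n : ℕ} {a a' : ℤ} (h : a' + 1 = a) : (path O).susp.X n a →ₗ[k] O.susp.X n a' :=
  (U (a' + 1 - n) (by omega) (n + 1) : X O n (a + 1 - n) →ₗ[k] O.X n (a' + 1 - n))

/-- The value of the `0`-cochain at a vertex, for elements of the suspension. -/
def vert {n : ℕ} {a : ℤ} (r : ℕ) : (path O).susp.X n a →ₗ[k] O.susp.X n a :=
  (w r : X O n (a + 1 - n) →ₗ[k] O.X n (a + 1 - n))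

theorem top_comp_susp_right {p q n : ℕ} {a b c b' c' : ℤ} (i : ℕ) (hi : 1 ≤ i ∧ i ≤ p)
    (hn : p + q = n + 1) (hc : a + b = c) (hb' : b' + 1 = b) (hc' : c' + 1 = c)
    (h : a + b' = c') (x : (path O).susp.X p a) (z : (path O).susp.X q b)
    (hz : ∀ r, vert r z = 0) :
    top hc' ((path O).susp.comp i hi hn hc x z) =
      (-1 : k) ^ (a + 1 - p) • O.susp.comp i hi hn h (vert i x) (top hb' z) := by
  have h1 := top_comp_right (O := O) (b' := b' + 1 - q) (c' := c' + 1 - n) i hi hn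
    (a := a + 1 - p) (b := b + 1 - q) (c := c + 1 - n) (by omega) (by omega) (by omega) (by omega)
    x z hz
  refine (map_smul (top hc') ((-1 : k) ^ (((q : ℤ) - 1) * (a + 1 - i))) _).trans ?_
  exact (congrArg (fun y => (-1 : k) ^ (((q : ℤ) - 1) * (a + 1 - i)) • y) h1).trans
    (smul_comm (N := k) (α := O.X n (c' + 1 - n)) _ _ _)

/-- The minus sign comes from the twist `(q - 1)(a + 1 - i)` with `q = 2`, whose exponent drops by
one when `a` is replaced by `a'`. -/
theorem top_comp_susp_left {p n : ℕ} {a b c a' c' : ℤ} (i : ℕ) (hi : 1 ≤ i ∧ i ≤ p)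
    (hn : p + 2 = n + 1) (hc : a + b = c) (ha' : a' + 1 = a) (hc' : c' + 1 = c)
    (h : a' + b = c') (z : (path O).susp.X p a) (x : (path O).susp.X 2 b)
    (hz : ∀ r, vert r z = 0) (hx : ∀ r, vert r x = vert 0 x) :
    top hc' ((path O).susp.comp i hi hn hc z x) =
      - O.susp.comp i hi hn h (top ha' z) (vert 0 x) := by
  have h1 := top_comp_left (O := O) (a' := a' + 1 - p) (c' := c' + 1 - n) i hi hn
    (a := a + 1 - p) (b := b + 1 - (2 : ℕ)) (c := c + 1 - n) (by omega) (by omega) (by omega)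
    (by omega) z x hz hx
  refine (map_smul (top hc') ((-1 : k) ^ ((((2 : ℕ) : ℤ) - 1) * (a + 1 - i))) _).trans ?_
  refine (congrArg (fun y => (-1 : k) ^ ((((2 : ℕ) : ℤ) - 1) * (a + 1 - i)) • y) h1).trans ?_
  have h2 : (-1 : k) ^ ((((2 : ℕ) : ℤ) - 1) * (a + 1 - i)) =
      (-1) * (-1 : k) ^ ((((2 : ℕ) : ℤ) - 1) * (a' + 1 - i)) := by
    refine Eq.trans ?_ (congrArg (· * _) (zpow_one (-1 : k)))
    rw [negOne_zpow_mul]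
    apply negOne_zpow_congr
    subst ha'
    exact ⟨0, by push_cast; ring⟩
  rw [h2]
  exact (mul_smul (β := O.X n (c' + 1 - n)) _ _ _).trans (neg_one_smul k _)

theorem top_brace_right {q n : ℕ} {b c b' c' : ℤ} (hn : 2 + q = n + 1) (hc : 1 + b = c)
    (hb' : b' + 1 = b) (hc' : c' + 1 = c) (h : 1 + b' = c') (x : (path O).susp.X 2 1)
    (z : (path O).susp.X q b) (hz : ∀ r, vert r z = 0) (hx : ∀ r, vert r x = vert 0 x) :
    top hc' ((path O).susp.brace hn hc x z) = O.susp.brace hn h (vert 0 x) (top hb' z) := by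
  rw [brace_apply, brace_apply, map_sum]
  refine Finset.sum_congr rfl fun i _ => ?_
  rw [top_comp_susp_right _ _ hn hc hb' hc' h x z hz, hx,
    show (-1 : k) ^ ((1 : ℤ) + 1 - (2 : ℕ)) = 1 by norm_num, one_smul]

theorem top_brace_left {p n : ℕ} {a b c a' c' : ℤ} (hn : p + 2 = n + 1) (hc : a + b = c)
    (ha' : a' + 1 = a) (hc' : c' + 1 = c) (h : a' + b = c') (z : (path O).susp.X p a)
    (x : (path O).susp.X 2 b) (hz : ∀ r, vert r z = 0) (hx : ∀ r, vert r x = vert 0 x) :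
    top hc' ((path O).susp.brace hn hc z x) = - O.susp.brace hn h (top ha' z) (vert 0 x) := by
  rw [brace_apply, brace_apply, map_sum, ← Finset.sum_neg_distrib]
  exact Finset.sum_congr rfl fun i _ => top_comp_susp_left _ _ hn hc ha' hc' h z x hz hx

/-- There are no 2-cochains on an interval, so a composite of two 1-cochains is zero. -/
theorem top_star_eq_zero {n : ℕ} {a b c c' : ℤ} (hc : a + b = c) (hc' : c' + 1 = c)
    (x : ∀ n, (path O).susp.X n a) (y : ∀ n, (path O).susp.X n b)
    (hx : ∀ n r, vert r (x n) = 0) (hy : ∀ n r, vert r (y n) = 0) :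
    top hc' ((path O).susp.star hc x y n) = 0 := by
  simp only [star, map_sum]
  refine Finset.sum_eq_zero fun p _ => Finset.sum_eq_zero fun q _ => ?_
  by_cases hn : p + q = n + 1
  · rw [braceT_of_eq _ _ hn, brace_apply, map_sum]
    refine Finset.sum_eq_zero fun i _ => ?_
    rw [top_comp_susp_right (b' := b - 1) _ _ hn hc (by omega) hc' (by omega) _ _ (hy q), hx,
      map_zero, LinearMap.zero_apply, smul_zero]
  · rw [braceT_of_ne _ _ hn]
    exact map_zero _

theorem susp_d_eq_zero_iff {P : DGOperad.{u, w} k} {n : ℕ} {a b : ℤ} (h : a + 1 = b)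
    (x : P.susp.X n a) :
    P.susp.d h x = 0 ↔ P.d (n := n) (show a + 1 - n + 1 = b + 1 - n by omega) x = 0 := by
  have hs : (-1 : k) ^ (1 - (n : ℤ)) ≠ 0 := zpow_ne_zero _ (neg_ne_zero.2 one_ne_zero)
  exact (smul_eq_zero_iff_right hs)

theorem vert_eq_of_d_eq_zero {n : ℕ} {a b : ℤ} (h : a + 1 = b) {x : (path O).susp.X n a}
    (hx : (path O).susp.d h x = 0) (r : ℕ) : vert r x = vert 0 x :=
  w_eq_of_d_eq_zero (by omega) ((susp_d_eq_zero_iff h x).1 hx) r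

theorem susp_d_eq_zero {n : ℕ} {a b : ℤ} (h : a + 1 = b) {x : (path O).susp.X n a}
    (hx : ∀ r, vert r x = vert 0 x) : (path O).susp.d h x = 0 :=
  (susp_d_eq_zero_iff h x).2 (d_eq_zero (by omega) hx)

/-- Up to sign, this is the difference of the values of `x` at the two ends. -/
theorem top_d {n : ℕ} {a b : ℤ} (h : a + 1 = b) {x : (path O).susp.X n a}
    (h0 : vert 0 x = 0) (h1 : vert (n + 1) x = 0) : top h ((path O).susp.d h x) = 0 := by
  refine (map_smul (top h) ((-1 : k) ^ (1 - (n : ℤ))) _).trans ?_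
  refine (congrArg (fun y => (-1 : k) ^ (1 - (n : ℤ)) • y) ((?_ : _ = (vert 0 x - vert (n + 1) x
    : O.susp.X n a)).trans ?_)).trans (smul_zero _)
  · rfl
  · rw [h0, h1, sub_zero]

/-- Cocycles that vanish at both ends, with vanishing primitive at the final vertex, are
coboundaries of elements that vanish at both ends. -/
theorem exists_primitive {n : ℕ} {a b : ℤ} (h : a + 1 = b) {z : (path O).susp.X n b}
    (hz : ∀ r, vert r z = 0) (htop : top h z = 0) :
    ∃ x : (path O).susp.X n a, (path O).susp.d h x = -z ∧ vert 0 x = 0 ∧ vert (n + 1) x = 0 := by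
  have h' : a + 1 - n + 1 = b + 1 - n := by omega
  -- The primitive of `z` as a 0-cochain: it vanishes at vertex 0 by normalisation and at the last
  -- vertex by `htop`.
  let y : X O n (a + 1 - n) := mk (fun r => U (a + 1 - n) h' r (show X O n (b + 1 - n) from z))
    (fun _ _ _ => 0) (fun r hr => U_of_le (show X O n (b + 1 - n) from z) _ _ hr)
    (fun _ _ => ⟨rfl, fun _ _ => rfl⟩)
  have hy : d h' y = -(show X O n (b + 1 - n) from z) := by
    refine ext (fun r => ?_) fun b' hb' r => ?_
    · rw [map_neg]
      exact (neg_eq_zero.2 (hz r)).symm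
    · obtain rfl : b' = a + 1 - n := by omega
      rw [U_d, map_neg]
      change U _ _ 0 (show X O n (b + 1 - n) from z) - U _ _ r (show X O n (b + 1 - n) from z) = _
      rw [U_zero, zero_sub]
  have hs : (-1 : k) ^ (1 - (n : ℤ)) * (-1 : k) ^ (1 - (n : ℤ)) = 1 := by
    rw [negOne_zpow_mul, Even.neg_one_zpow ⟨_, rfl⟩]
  refine ⟨((-1 : k) ^ (1 - (n : ℤ)) • y : X O n (a + 1 - n)), ?_, ?_, ?_⟩
  · refine (congrArg (fun y => (-1 : k) ^ (1 - (n : ℤ)) • y)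
      (map_smul (d h') ((-1 : k) ^ (1 - (n : ℤ))) y)).trans ?_
    refine (smul_smul _ _ _).trans ?_
    rw [hs, hy]
    exact one_smul _ _
  · refine (map_smul (w (O := O) 0) ((-1 : k) ^ (1 - (n : ℤ))) y).trans ?_
    exact (congrArg _ (U_zero (show X O n (b + 1 - n) from z) _ h')).trans (smul_zero (A := O.X n (a + 1 - n)) _)
  · refine (map_smul (w (O := O) (n + 1)) ((-1 : k) ^ (1 - (n : ℤ))) y).trans ?_
    exact (congrArg _ htop).trans (smul_zero (A := O.X n (a + 1 - n)) _)

end Path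

/-! ### Curvature in low arities, and its change under a change in one arity. -/

section Curvature

variable {Q : DGOperad.{u, v} k}

theorem curv_add (h e : ∀ n, Q.X n 1) (n : ℕ) :
    curv (h + e) n = curv h n + (Q.d (b := 2) rfl (e n) + Q.star (c := 2) rfl h e n +
      Q.star (c := 2) rfl e h n + Q.star (c := 2) rfl e e n) := by
  rw [curv, curv, star_add_left, star_add_right, star_add_right, Pi.add_apply, map_add]
  abel

theorem eq_zero_of_lt_two {h : ∀ n, Q.X n 1} (h0 : h 0 = 0) (h1 : h 1 = 0) {p : ℕ}
    (hp : p < 2) : h p = 0 := by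
  interval_cases p
  · exact h0
  · exact h1

theorem curv_eq_zero_of_lt_two {h : ∀ n, Q.X n 1} (h0 : h 0 = 0) (h1 : h 1 = 0) {n : ℕ}
    (hn : n < 2) : curv h n = 0 := by
  rw [curv, eq_zero_of_lt_two h0 h1 hn, map_zero, zero_add]
  refine star_eq_zero _ fun p q hpq => ?_
  by_cases hp : p < 2
  · exact Or.inl (eq_zero_of_lt_two h0 h1 hp)
  · exact Or.inr (eq_zero_of_lt_two h0 h1 (by omega))

/-- In arities up to `n`, a product involving `x` would need a second factor of arity at most 1, so
only the linear term remains. -/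
theorem curv_add_single_of_le {h : ∀ n, Q.X n 1} (h0 : h 0 = 0) (h1 : h 1 = 0) {m n : ℕ}
    (hn : 2 ≤ n) (hm : m ≤ n) (x : Q.X n 1) :
    curv (h + Pi.single n x) m =
      curv h m + Q.d (b := 2) rfl ((Pi.single n x : ∀ n, Q.X n 1) m) := by
  have he : ∀ p, p ≠ n → (Pi.single n x : ∀ n, Q.X n 1) p = 0 := fun p hp => by
    rw [Pi.single_eq_of_ne hp]
  rw [curv_add, star_eq_zero (x := h), star_eq_zero (y := h), star_eq_zero, add_zero, add_zero,
    add_zero]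
  · intro p q hpq
    by_cases hp : p = n
    · exact Or.inr (he q (by omega))
    · exact Or.inl (he p hp)
  · intro p q hpq
    by_cases hp : p = n
    · exact Or.inr (eq_zero_of_lt_two h0 h1 (by omega))
    · exact Or.inl (he p hp)
  · intro p q hpq
    by_cases hq : q = n
    · exact Or.inl (eq_zero_of_lt_two h0 h1 (by omega))
    · exact Or.inr (he q hq)

/-- In arity `n + 1`, the operation `x` pairs only with the binary one. The quadratic term is kept
because it can be nonzero for `n = 2`. -/
theorem curv_add_single_succ {h : ∀ n, Q.X n 1} {n : ℕ} (x : Q.X n 1) :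
    curv (h + Pi.single n x) (n + 1) = curv h (n + 1) +
      (Q.brace (c := 2) (by omega) rfl (h 2) x + Q.brace (c := 2) (by omega) rfl x (h 2) +
        Q.star (c := 2) rfl (Pi.single n x) (Pi.single n x) (n + 1)) := by
  have he : ∀ p, p ≠ n → (Pi.single n x : ∀ n, Q.X n 1) p = 0 := fun p hp => by
    rw [Pi.single_eq_of_ne hp]
  rw [curv_add, star_eq_brace (x := h) (p := 2) (q := n) rfl (by omega),
    star_eq_brace (y := h) (p := n) (q := 2) rfl (by omega), he (n + 1) (by omega), map_zero,
    zero_add, Pi.single_eq_same]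
  · exact fun p q _ hp => Or.inl (he p hp)
  · exact fun p q _ hp => Or.inr (he q (by omega))

/-- The products in the Bianchi identity pair curvature of arity above `n` with operations of arity
at least 2, so they start in arity `n + 2`. There the only pair of arities is `(n + 1, 2)`, which is
the companion lemma `d_curv_succ_succ`. -/
theorem d_curv_succ {h : ∀ n, Q.X n 1} (h0 : h 0 = 0) (h1 : h 1 = 0) {n : ℕ}
    (hF : ∀ m ≤ n, curv h m = 0) : Q.d (b := 3) rfl (curv h (n + 1)) = 0 := by
  rw [d_curv h h0, star_eq_zero, star_eq_zero, sub_zero]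
  · intro p q hpq
    by_cases hq : q ≤ n
    · exact Or.inr (hF q hq)
    · exact Or.inl (eq_zero_of_lt_two h0 h1 (by omega))
  · intro p q hpq
    by_cases hp : p ≤ n
    · exact Or.inl (hF p hp)
    · exact Or.inr (eq_zero_of_lt_two h0 h1 (by omega))

theorem d_curv_succ_succ {h : ∀ n, Q.X n 1} (h0 : h 0 = 0) (h1 : h 1 = 0) {n : ℕ}
    (hF : ∀ m ≤ n, curv h m = 0) : Q.d (b := 3) rfl (curv h (n + 2)) =
      Q.brace (c := 3) (by omega) rfl (curv h (n + 1)) (h 2) -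
        Q.brace (c := 3) (by omega) rfl (h 2) (curv h (n + 1)) := by
  rw [d_curv h h0, star_eq_brace (x := h) (p := 2) (q := n + 1) rfl (by omega),
    star_eq_brace (y := h) (p := n + 1) (q := 2) rfl (by omega)]
  · intro p q hpq hp
    by_cases hp' : p ≤ n
    · exact Or.inl (hF p hp')
    · exact Or.inr (eq_zero_of_lt_two h0 h1 (by omega))
  · intro p q hpq hp
    by_cases hq : q ≤ n
    · exact Or.inr (hF q hq)
    · exact Or.inl (eq_zero_of_lt_two h0 h1 (by omega))

/-- The vanishing of a cohomology group of the operad complex, for degrees that agree only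
propositionally with those of the complex. -/
theorem exists_bracket_eq {m : Q.X 2 1} {p : ℕ} {q : ℤ} (hH : Subsingleton (Q.OH m (p + 1) q))
    {a b c : ℤ} (ha : a = p + q - 1) (hb : b = (p + 1 : ℕ) + q - 1)
    (hc : c = (p + 1 + 1 : ℕ) + q - 1) (hab : 1 + a = b) (hbc : 1 + b = c)
    (x : Q.X (p + 1) b)
    (hx : (Q.bracket (by omega) hbc m x : Q.X (p + 1 + 1) c) = 0) :
    ∃ y : Q.X p a, Q.bracket (by omega) hab m y = x := by
  subst ha hb hc
  have h := (Submodule.Quotient.mk_eq_zero _).1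
    (hH.elim (Submodule.Quotient.mk (⟨x, hx⟩ : Q.OZ m (p + 1) q)) 0)
  exact h

end Curvature

/-! ### Obstruction theory for homotopies. -/

namespace Path

variable {O : DGOperad.{u, v} k}

/-- Families of operations of the path operad from a family `G` to a family `F`, vanishing in
arities below `2`, with curvature vanishing in arities up to `n`. -/
structure Approx (O : DGOperad.{u, v} k) (G F : ∀ n, O.susp.X n 1) (n : ℕ)
    (h : ∀ n, (path O).susp.X n 1) : Prop where
  zero : h 0 = 0
  one : h 1 = 0
  source : ∀ m, vert 0 (h m) = G m
  target : ∀ m, vert (m + 1) (h m) = F m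
  curvature : ∀ m ≤ n, curv h m = 0

variable {G F : ∀ n, O.susp.X n 1}

theorem vert_zero_curv (hO : O.IsGraded) {h : ∀ n, (path O).susp.X n 1}
    (hs : ∀ m, vert 0 (h m) = G m) (hG : ∀ m, curv G m = 0) (m : ℕ) :
    vert 0 (curv h m) = 0 := by
  have := (source hO).susp.app_curv h m
  rw [show (fun n => (source hO).susp.app n 1 (h n)) = G from funext hs, hG] at this
  exact this

theorem vert_last_curv (hO : O.IsGraded) {h : ∀ n, (path O).susp.X n 1}
    (hs : ∀ m, vert (m + 1) (h m) = F m) (hF : ∀ m, curv F m = 0) (m : ℕ) :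
    vert (m + 1) (curv h m) = 0 := by
  have := (target hO).susp.app_curv h m
  rw [show (fun n => (target hO).susp.app n 1 (h n)) = F from funext hs, hF] at this
  exact this

theorem Approx.add_single {n N M : ℕ} {h : ∀ n, (path O).susp.X n 1} (hh : Approx O G F N h)
    (hn : 2 ≤ n) {x : (path O).susp.X n 1} (h0 : vert 0 x = 0) (h1 : vert (n + 1) x = 0)
    (hc : ∀ m ≤ M, curv (h + Pi.single n x) m = 0) :
    Approx O G F M (h + Pi.single n x) where
  zero := by rw [Pi.add_apply, Pi.single_eq_of_ne (by omega), hh.zero, add_zero]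
  one := by rw [Pi.add_apply, Pi.single_eq_of_ne (by omega), hh.one, add_zero]
  source m := by
    rw [Pi.add_apply, map_add, hh.source]
    by_cases hm : m = n
    · subst hm
      rw [Pi.single_eq_same, h0, add_zero]
    · rw [Pi.single_eq_of_ne hm, map_zero, add_zero]
  target m := by
    rw [Pi.add_apply, map_add, hh.target]
    by_cases hm : m = n
    · subst hm
      rw [Pi.single_eq_same, h1, add_zero]
    · rw [Pi.single_eq_of_ne hm, map_zero, add_zero]
  curvature := hc

/-- The first possibly nonzero curvature is a cocycle, hence constant on vertices, and at the
initial vertex it is the curvature of `G`. -/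
theorem Approx.vert_curv (hO : O.IsGraded) (hG : ∀ m, curv G m = 0) {n : ℕ} {h : ∀ n, (path O).susp.X n 1} (hh : Approx O G F n h) (r : ℕ) :
    vert r (curv h (n + 1)) = 0 := by
  rw [vert_eq_of_d_eq_zero rfl (d_curv_succ hh.zero hh.one hh.curvature),
    vert_zero_curv hO hh.source hG]

/-- The arity 2 curvature is just the differential of `h 2`. Only the vertices of `h 2` are fixed;
its 1-cochain part changes in the first inductive step. -/
theorem Approx.vert_two {n : ℕ} (hn : 2 ≤ n) {h : ∀ n, (path O).susp.X n 1}
    (hh : Approx O G F n h) (r : ℕ) : vert r (h 2) = G 2 := by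
  have h2 := hh.curvature 2 hn
  rw [DGOperad.curv, star_eq_zero, add_zero] at h2
  · rw [vert_eq_of_d_eq_zero rfl h2, hh.source]
  · intro p q hpq
    by_cases hp : p < 2
    · exact Or.inl (eq_zero_of_lt_two hh.zero hh.one hp)
    · exact Or.inr (eq_zero_of_lt_two hh.zero hh.one (by omega))

/-- Evaluate the Bianchi identity of arity `n + 2` at the final vertex. The left side gives zero
because the curvature vanishes at both ends; the right side is minus the bracket, as both degrees
are 1. -/
theorem Approx.bracket_top (hO : O.IsGraded) (hG : ∀ m, curv G m = 0)
    (hF : ∀ m, curv F m = 0) {n : ℕ} (hn : 2 ≤ n) {h : ∀ n, (path O).susp.X n 1}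
    (hh : Approx O G F n h) :
    (O.susp.bracket (by omega) rfl (G 2) (top (a' := 1) rfl (curv h (n + 1))) :
      O.susp.X (n + 2) 2) = 0 := by
  have hv := hh.vert_two hn
  have h1 := congrArg (top (a' := 2) rfl) (d_curv_succ_succ hh.zero hh.one hh.curvature)
  rw [top_d rfl (vert_zero_curv hO hh.source hG _) (vert_last_curv hO hh.target hF _), map_sub,
    top_brace_left (a' := 1) _ _ rfl _ rfl _ _ (hh.vert_curv hO hG)
      fun r => (hv r).trans (hv 0).symm,
    top_brace_right (b' := 1) _ _ rfl _ rfl _ _ (hh.vert_curv hO hG)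
      fun r => (hv r).trans (hv 0).symm, hv 0] at h1
  have h2 : (-1 : k) ^ ((1 : ℤ) * 1) = -1 := by norm_num
  simp only [bracket, h2, LinearMap.sub_apply, LinearMap.smul_apply, LinearMap.flip_apply,
    neg_smul, one_smul, sub_neg_eq_add, LinearMap.add_apply]
  rw [← neg_eq_zero, neg_add_rev, ← sub_eq_add_neg]
  exact h1.symm

theorem Approx.exists_succ (hO : O.IsGraded) (hG : ∀ m, curv G m = 0)
    (hF : ∀ m, curv F m = 0) {n : ℕ} (hn : 1 ≤ n)
    (hH : Subsingleton (O.susp.OH (G 2) (n + 2) (-(n : ℤ)))) {h : ∀ n, (path O).susp.X n 1}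
    (hh : Approx O G F (n + 1) h) :
    ∃ h', Approx O G F (n + 2) h' ∧ ∀ m < n + 1, h' m = h m := by
  have hv := hh.vert_two (by omega)
  -- This is where the cohomological hypothesis enters: the obstruction has arity `n + 2` and degree
  -- 1, hence bidegree `(n + 2, -n)`.
  obtain ⟨δ, hδ⟩ := exists_bracket_eq (a := 0) (b := 1) (c := 2) hH (by push_cast; ring)
    (by push_cast; ring) (by push_cast; ring) rfl rfl _ (hh.bracket_top hO hG hF (by omega))
  obtain ⟨x, hxw, hxtop⟩ : ∃ x : (path O).susp.X (n + 1) 1,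
      (∀ r, vert r x = 0) ∧ top (a' := 0) rfl x = -δ :=
    ⟨step (O := O) (b := 0 + 1 - (n + 1 : ℕ)) (by omega) (-δ), fun r => rfl,
      U_step _ _ _ (by omega)⟩
  have hdx : (path O).susp.d (b := 2) rfl x = 0 := susp_d_eq_zero rfl fun r => (hxw r).trans (hxw 0).symm
  have hew : ∀ m r, vert r ((Pi.single (n + 1) x : ∀ n, (path O).susp.X n 1) m) = 0 := by
    intro m r
    by_cases hm : m = n + 1
    · subst hm
      rw [Pi.single_eq_same, hxw]
    · rw [Pi.single_eq_of_ne hm, map_zero]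
  -- As `x` is a cocycle vanishing on vertices, the ends and the curvature through arity `n + 1` do
  -- not change.
  have hh1 : Approx O G F (n + 1) (h + Pi.single (n + 1) x) :=
    hh.add_single (by omega) (hxw _) (hxw _) fun m hm => by
      rw [curv_add_single_of_le hh.zero hh.one (by omega) hm, hh.curvature m hm, zero_add]
      by_cases hm : m = n + 1
      · subst hm
        rw [Pi.single_eq_same, hdx]
      · rw [Pi.single_eq_of_ne hm, map_zero]
  -- The linear change is `m₂{-δ} - (-δ){m₂} = -[m₂, δ]`, which cancels the obstruction. The
  -- quadratic term `x{x}`, present only for `n = 1`, has no `top`.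
  have htop : top (a' := 1) rfl (curv (h + Pi.single (n + 1) x) (n + 2)) = 0 := by
    have h2 : (-1 : k) ^ ((1 : ℤ) * 0) = 1 := by norm_num
    rw [curv_add_single_succ, map_add, map_add, map_add, top_star_eq_zero _ _ _ _ hew hew,
      top_brace_right (b' := 0) _ _ rfl _ rfl _ _ hxw fun r => (hv r).trans (hv 0).symm,
      top_brace_left (a' := 0) _ _ rfl _ rfl _ _ hxw fun r => (hv r).trans (hv 0).symm, hv 0,
      hxtop, ← hδ]
    simp only [bracket, h2, LinearMap.sub_apply, LinearMap.flip_apply, one_smul, map_neg, LinearMap.neg_apply]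
    abel
  -- With its class gone, the curvature in arity `n + 2` is a coboundary relative to the ends, and
  -- `y` removes it.
  obtain ⟨y, hy, hy0, hy1⟩ := exists_primitive (a := 1) rfl (hh1.vert_curv hO hG) htop
  refine ⟨h + Pi.single (n + 1) x + Pi.single (n + 2) y,
    hh1.add_single (by omega) hy0 hy1 fun m hm => ?_, fun m hm => ?_⟩
  · rw [curv_add_single_of_le hh1.zero hh1.one (by omega) hm]
    by_cases hm' : m = n + 2
    · subst hm'
      rw [Pi.single_eq_same, hy, add_neg_cancel]
    · rw [Pi.single_eq_of_ne hm', map_zero, add_zero, hh1.curvature m (by omega)]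
  · rw [Pi.add_apply, Pi.add_apply, Pi.single_eq_of_ne (by omega), Pi.single_eq_of_ne (by omega),
      add_zero, add_zero]

/-- Jump from `G` to `F` between vertices 0 and 1. Equality of the binary operations makes this path
constant in arity 2, hence closed. -/
theorem exists_approx_two (hG0 : G 0 = 0) (hG1 : G 1 = 0) (hF0 : F 0 = 0)
    (hF1 : F 1 = 0) (hGF : G 2 = F 2) : ∃ h, Approx O G F 2 h := by
  have hex : ∀ n, ∃ x : (path O).susp.X n 1, (n < 2 → x = 0) ∧
      ∀ r, vert r x = if r = 0 then G n else F n := by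
    intro n
    by_cases hn : n < 2
    · refine ⟨0, fun _ => rfl, fun r => ?_⟩
      rw [eq_zero_of_lt_two hG0 hG1 hn, eq_zero_of_lt_two hF0 hF1 hn, ite_self, map_zero]
    · exact ⟨mk (fun r => if r = 0 then G n else F n) (fun _ _ _ => 0)
        (fun r hr => (if_neg (by omega)).trans (if_neg (by omega)).symm)
        (fun _ _ => ⟨rfl, fun _ _ => rfl⟩), fun h => absurd h hn, fun _ => rfl⟩
  choose h hz hv using hex
  have h0 := hz 0 (by omega)
  have h1 := hz 1 (by omega)
  refine ⟨h, h0, h1, fun m => (hv m 0).trans (if_pos rfl),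
    fun m => (hv m (m + 1)).trans (if_neg (by omega)), fun m hm => ?_⟩
  by_cases hm' : m < 2
  · exact curv_eq_zero_of_lt_two h0 h1 hm'
  · obtain rfl : m = 2 := by omega
    rw [curv, star_eq_zero, add_zero]
    · refine susp_d_eq_zero rfl fun r => ?_
      rw [hv, hv, hGF, ite_self, ite_self]
    · intro p q hpq
      by_cases hp : p < 2
      · exact Or.inl (hz p hp)
      · exact Or.inr (hz q (by omega))

theorem exists_forall_approx (hO : O.IsGraded) (hG : ∀ m, curv G m = 0)
    (hF : ∀ m, curv F m = 0) (hG0 : G 0 = 0) (hG1 : G 1 = 0) (hF0 : F 0 = 0)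
    (hF1 : F 1 = 0) (hGF : G 2 = F 2)
    (hH : ∀ n : ℕ, 1 ≤ n → Subsingleton (O.susp.OH (G 2) (n + 2) (-(n : ℤ)))) :
    ∃ h, ∀ n, Approx O G F n h := by
  have hstep : ∀ (n : ℕ) (h : {h // Approx O G F (n + 2) h}),
      ∃ h' : {h // Approx O G F (n + 3) h}, ∀ m < n + 2, h'.1 m = h.1 m := fun n h => by
    obtain ⟨h', hh', he⟩ := Approx.exists_succ hO hG hF (n := n + 1) (by omega)
      (hH (n + 1) (by omega)) h.2
    exact ⟨⟨h', hh'⟩, he⟩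
  choose next hnext using hstep
  obtain ⟨h₀, hh₀⟩ := exists_approx_two hG0 hG1 hF0 hF1 hGF
  let s : ∀ n : ℕ, {h // Approx O G F (n + 2) h} := fun n =>
    Nat.rec (motive := fun n => {h // Approx O G F (n + 2) h}) ⟨h₀, hh₀⟩ next n
  have hs : ∀ n m, m < n + 2 → (s (n + 1)).1 m = (s n).1 m := fun n => hnext n (s n)
  have hs' : ∀ m j, (s (m + j)).1 m = (s m).1 m := by
    intro m j
    induction j with
    | zero => rfl
    | succ j ih => exact (hs (m + j) m (by omega)).trans ih
  -- The diagonal is the limit, since the component of arity `m` no longer changes from stage `m`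
  -- on. The curvature in arity `m` involves only arities below `m + 2`, so stage `m + 2` computes
  -- it.
  refine ⟨fun n => (s n).1 n, fun n => ⟨(s 0).2.zero, (s 1).2.one, fun m => (s m).2.source m,
    fun m => (s m).2.target m, fun m _ => ?_⟩⟩
  rw [curv_congr (h' := (s (m + 2)).1)]
  · exact (s (m + 2)).2.curvature m (by omega)
  · intro p hp
    obtain ⟨j, hj⟩ := Nat.exists_eq_add_of_le (show p ≤ m + 2 by omega)
    rw [hj, hs']

end Path

/-! ### Homotopies, the strict morphism and the main theorem. -/

/-- Morphisms from the `A∞`-operad to a graded operad with the same binary operation are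
homotopic if the relevant cohomology groups of the operad complex vanish. -/
theorem homotopic_of_op_two_eq {O : DGOperad.{u, v} k} (hO : O.IsGraded) {f g : Hom (AInf k) O}
    (hfg : g.op 2 le_rfl = f.op 2 le_rfl)
    (hH : ∀ n : ℕ, 1 ≤ n → Subsingleton (O.susp.OH (g.op 2 le_rfl) (n + 2) (-(n : ℤ)))) :
    g.Homotopic f := by
  have h2 : ∀ f : Hom (AInf k) O, extend (P := O.susp) f.op 2 = f.op 2 le_rfl := fun f =>
    extend_of_le (P := O.susp) f.op le_rfl
  obtain ⟨h, hh⟩ := Path.exists_forall_approx hO ((isAInf_iff_curv _ _).1 g.isAInf_op)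
    ((isAInf_iff_curv _ _).1 f.isAInf_op) (extend_of_lt _ (by omega)) (extend_of_lt _ (by omega))
    (extend_of_lt _ (by omega)) (extend_of_lt _ (by omega)) (by rw [h2, h2, hfg])
    (by rw [h2]; exact hH)
  have hM : IsAInf (path O) fun n _ => h n := by
    rw [isAInf_iff_curv]
    intro n
    have he : extend (P := (path O).susp) (fun n _ => h n) = h := by
      funext m
      by_cases hm : 2 ≤ m
      · rw [extend_of_le _ hm]
      · rw [extend_of_lt _ (by omega), eq_zero_of_lt_two (hh 0).zero (hh 0).one (by omega)]
    rw [he, (hh n).curvature n le_rfl]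
  refine ⟨pathObject hO, AInf.lift _ hM, AInf.hom_ext fun n hn => ?_,
    AInf.hom_ext fun n hn => ?_⟩
  · exact ((hh 0).source n).trans (extend_of_le (P := O.susp) g.op hn)
  · exact ((hh 0).target n).trans (extend_of_le (P := O.susp) f.op hn)

/-- The family given by a binary operation. -/
def binaryFamily {P : DGOperad.{u, v} k} (m : P.X 2 1) : ∀ n : ℕ, 2 ≤ n → P.X n 1
  | 2, _ => m
  | _ + 3, _ => 0

theorem extend_binaryFamily_of_ne {P : DGOperad.{u, v} k} (m : P.X 2 1) {n : ℕ} (hn : n ≠ 2) :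
    extend (binaryFamily m) n = 0 := by
  match n, hn with
  | 0, _ => rfl
  | 1, _ => rfl
  | n + 3, _ => exact extend_of_le _ (by omega)

theorem isAInf_binaryFamily {O : DGOperad.{u, v} k} (hO : O.IsGraded) {m : O.susp.X 2 1}
    (hm : O.susp.IsMultiplication m) : IsAInf O (binaryFamily m) := by
  rw [isAInf_iff_curv]
  intro n
  have hd : ∀ x : O.susp.X n 1, O.susp.d (b := 2) rfl x = 0 := fun x =>
    (Path.susp_d_eq_zero_iff _ x).2 (hO _ _)
  rw [curv, hd, zero_add]
  by_cases hn : n = 3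
  · subst hn
    rw [star_eq_brace (p := 2) (q := 2) _ rfl
      fun p q _ hp => Or.inl (extend_binaryFamily_of_ne m hp)]
    exact hm
  · refine star_eq_zero _ fun p q hpq => ?_
    by_cases hp : p = 2
    · exact Or.inr (extend_binaryFamily_of_ne m (by omega))
    · exact Or.inl (extend_binaryFamily_of_ne m hp)

/-- The suspension twists `∘₁` by `-1` and `∘₂` by `1`, so `m{m}` is the negative of the associator
in `O`. -/
theorem isAssoc_of_isMultiplication {O : DGOperad.{u, v} k} {m : O.susp.X 2 1}
    (hm : O.susp.IsMultiplication m) : IsAssoc (O := O) m := by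
  have h := hm
  rw [IsMultiplication, brace_apply, Fin.sum_univ_two] at h
  have key : ∀ x y : O.X 3 0, (-1 : k) ^ ((((2 : ℕ) : ℤ) - 1) * (1 + 1 - ((0 + 1 : ℕ) : ℤ))) • x +
      (-1 : k) ^ ((((2 : ℕ) : ℤ) - 1) * (1 + 1 - ((1 + 1 : ℕ) : ℤ))) • y = 0 → x = y := by
    intro x y hxy
    norm_num at hxy
    exact (neg_add_eq_zero.1 hxy)
  exact key _ _ h

end DGOperad

theorem mainTheorem7 {k : Type u} [Field k] (O : DGOperad.{u, v} k) (hO : O.IsGraded)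
    (m₂ : O.susp.X 2 1) (hm₂ : O.susp.IsMultiplication m₂)
    (hH : ∀ n : ℕ, 1 ≤ n → Subsingleton (O.susp.OH m₂ (n + 2) (-(n : ℤ)))) :
    (∃! f : DGOperad.Hom (DGOperad.AInf k) O,
      f.op 2 le_rfl = m₂ ∧ ∀ (n : ℕ) (hn : 3 ≤ n), f.op n (by omega) = 0) ∧
    ∀ f : DGOperad.Hom (DGOperad.AInf k) O,
      f.op 2 le_rfl = m₂ → (∀ (n : ℕ) (hn : 3 ≤ n), f.op n (by omega) = 0) →
        (∃ φ : DGOperad.Hom (DGOperad.Ass k) O,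
          φ.app 2 0 (DGOperad.Ass.μ k) = m₂ ∧ f = φ.comp (DGOperad.AInf.toAss k)) ∧
        ∀ g : DGOperad.Hom (DGOperad.AInf k) O, g.op 2 le_rfl = m₂ → g.Homotopic f := by
  have huniq : ∀ f g : DGOperad.Hom (DGOperad.AInf k) O,
      (f.op 2 le_rfl = m₂ ∧ ∀ (n : ℕ) (hn : 3 ≤ n), f.op n (by omega) = 0) →
      (g.op 2 le_rfl = m₂ ∧ ∀ (n : ℕ) (hn : 3 ≤ n), g.op n (by omega) = 0) → f = g := by
    intro f g hf hg
    refine DGOperad.AInf.hom_ext fun n hn => ?_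
    rcases hn.eq_or_lt with rfl | hn'
    · exact hf.1.trans hg.1.symm
    · exact (hf.2 n hn').trans (hg.2 n hn').symm
  refine ⟨⟨DGOperad.AInf.lift _ (DGOperad.isAInf_binaryFamily hO hm₂), ⟨rfl, fun n hn => ?_⟩,
    fun g hg => huniq _ _ hg ⟨rfl, fun n hn => ?_⟩⟩, fun f hf2 hf => ⟨?_, fun g hg => ?_⟩⟩
  · obtain ⟨n, rfl⟩ := Nat.exists_eq_add_of_le' hn
    rfl
  · obtain ⟨n, rfl⟩ := Nat.exists_eq_add_of_le' hn
    rfl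
  · have hφ : (DGOperad.fromAss hO (DGOperad.isAssoc_of_isMultiplication hm₂)).app 2 0
        (DGOperad.Ass.μ k) = m₂ :=
      -- The iterated product of length 2 is by definition `m₂` composed with the identity.
      (one_smul k _).trans (O.comp_one 1 (by omega) rfl (add_zero 0) m₂)
    refine ⟨_, hφ, huniq _ _ ⟨hf2, hf⟩ ⟨hφ, fun n hn => ?_⟩⟩
    obtain ⟨n, rfl⟩ := Nat.exists_eq_add_of_le' hn
    exact map_zero ((DGOperad.fromAss hO (DGOperad.isAssoc_of_isMultiplication hm₂)).app (n + 3)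
      (1 + 1 - (n + 3 : ℕ)))
  · refine DGOperad.homotopic_of_op_two_eq hO (hg.trans hf2.symm) ?_
    rw [hg]
    exact hH
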